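/- Let $d,m\ge 1$ be integers, $\sigma\in(0,1)$, $\mathbb T=\mathbb R/2\pi\mathbb Z$, and $\Omega=\mathbb R^d\times\mathbb T^m$ with its standard product measure. For $u\in L^2(\Omega;\mathbb C)$ let $\hat u(\xi,k)$, $(\xi,k)\in\mathbb R^d\times\mathbb Z^m$, be its Fourier transform. Let $(-\Delta)^{\sigma/2}$ be the Fourier multiplier with symbol $(|\xi|^2+|k|^2)^{\sigma/2}$, and let $H^\sigma(\Omega)$ be the space of all $u\in L^2(\Omega;\mathbb C)$ with $$\sum_{k\in\mathbb Z^m}\int_{\mathbb R^d}(1+|\xi|^2+|k|^2)^{\sigma}\,|\hat u(\xi,k)|^2\,d\xi<\infty .$$ For $\alpha>0$ and $c>0$ put $$E(u)=\tfrac12\|(-\Delta)^{\sigma/2}u\|_{L^2(\Omega)}^2-\tfrac1{\alpha+2}\|u\|_{L^{\alpha+2}(\Omega)}^{\alpha+2},\qquad S(c)=\{u\in H^\sigma(\Omega):\|u\|_{L^2(\Omega)}^2=c\},\qquad m_c=\inf_{u\in S(c)}E(u).$$ **Theorem (Existence of normalized ground states).** Let $\alpha\in\left(0,\frac{4\sigma}{d+m}\right)$.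 Then for every $c\in(0,\infty)$ we have $m_c\in(-\infty,0)$, and $m_c$ possesses a minimizer: there is $u\in S(c)$ with $E(u)=m_c$. -/

import Mathlib

open MeasureTheory
open scoped ENNReal FourierTransform

namespace Waveguide

instance fact_two_pi_pos : Fact ((0 : ℝ) < 2 * Real.pi) := ⟨Real.two_pi_pos⟩

/-- The flat torus `𝕋^m` with `𝕋 = ℝ / 2πℤ`; its volume is `(2π)^m`. -/
abbrev Torus (m : ℕ) : Type := Fin m → AddCircle (2 * Real.pi)

/-- The waveguide manifold `ℝ^d × 𝕋^m`. It is only used as a measure space, with the product of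
Lebesgue measure on `ℝ^d` and the volume of `𝕋^m`. -/
abbrev Domain (d m : ℕ) : Type := EuclideanSpace ℝ (Fin d) × Torus m

/-- The space `L²(ℝ^d × 𝕋^m; ℂ)`. -/
abbrev L2 (d m : ℕ) : Type := Lp ℂ 2 (volume : Measure (Domain d m))

/-- The character `y ↦ exp (i k·y)` of the torus. -/
noncomputable def torusChar {m : ℕ} (k : Fin m → ℤ) (y : Torus m) : ℂ :=
  ∏ j, fourier (k j) (y j)

/-- The `k`-th Fourier coefficient of `u` in the torus variable, as a function of `x ∈ ℝ^d`:
`u_k(x) = (2π)^{-m} ∫_{𝕋^m} exp (-i k·y) u(x, y) dy`. -/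
noncomputable def torusCoeff {d m : ℕ} (u : Domain d m → ℂ) (k : Fin m → ℤ)
    (x : EuclideanSpace ℝ (Fin d)) : ℂ :=
  (((2 * Real.pi) ^ m)⁻¹ : ℝ) • ∫ y : Torus m, torusChar (-k) y * u (x, y)

theorem norm_torusChar {m : ℕ} (k : Fin m → ℤ) (y : Torus m) : ‖torusChar k y‖ = 1 := by
  rw [torusChar, norm_prod]
  exact Finset.prod_eq_one fun j _ => by rw [fourier_apply, Circle.norm_coe]

theorem continuous_torusChar {m : ℕ} (k : Fin m → ℤ) : Continuous (torusChar k) := by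
  unfold torusChar
  fun_prop

theorem memLp_torusCoeff {d m : ℕ} {u : Domain d m → ℂ} (hu : MemLp u 2) (k : Fin m → ℤ) :
    MemLp (torusCoeff u k) 2 := by
  have hF : AEStronglyMeasurable (fun p : Domain d m => torusChar (-k) p.2 * u p)
      ((volume : Measure (EuclideanSpace ℝ (Fin d))).prod (volume : Measure (Torus m))) :=
    (((continuous_torusChar (-k)).comp continuous_snd).aestronglyMeasurable).mul
      hu.aestronglyMeasurable
  suffices h : MemLp (fun x : EuclideanSpace ℝ (Fin d) =>
      ∫ y : Torus m, torusChar (-k) y * u (x, y)) 2 from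
    h.const_smul (((2 * Real.pi) ^ m)⁻¹ : ℝ)
  refine ⟨hF.integral_prod_right', ?_⟩
  have key : ∀ᵐ x : EuclideanSpace ℝ (Fin d),
      ‖∫ y : Torus m, torusChar (-k) y * u (x, y)‖ₑ ^ (2 : ℝ)
        ≤ (volume (Set.univ : Set (Torus m))) * ∫⁻ y : Torus m, ‖u (x, y)‖ₑ ^ (2 : ℝ) := by
    filter_upwards [hu.aestronglyMeasurable.prodMk_left] with x hx
    have h1 : ‖∫ y : Torus m, torusChar (-k) y * u (x, y)‖ₑ ≤ ∫⁻ y : Torus m, ‖u (x, y)‖ₑ := by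
      refine (enorm_integral_le_lintegral_enorm _).trans_eq (lintegral_congr fun y => ?_)
      have : ‖torusChar (-k) y‖ₑ = 1 := by
        rw [← ofReal_norm, norm_torusChar, ENNReal.ofReal_one]
      rw [enorm_mul, this, one_mul]
    have h2 := ENNReal.lintegral_mul_le_Lp_mul_Lq (volume : Measure (Torus m))
      Real.HolderConjugate.two_two (aemeasurable_const (b := (1 : ℝ≥0∞))) hx.enorm
    simp only [Pi.mul_apply, one_mul, ENNReal.one_rpow, lintegral_one] at h2
    refine (ENNReal.rpow_le_rpow (h1.trans h2) (by norm_num)).trans_eq ?_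
    rw [ENNReal.mul_rpow_of_nonneg _ _ (by norm_num), ← ENNReal.rpow_mul, ← ENNReal.rpow_mul]
    norm_num
  rw [eLpNorm_lt_top_iff_lintegral_rpow_enorm_lt_top (by norm_num) (by norm_num)]
  have hfin : ∫⁻ p : Domain d m, ‖u p‖ₑ ^ (2 : ℝ) < ∞ := by
    have h := (eLpNorm_lt_top_iff_lintegral_rpow_enorm_lt_top (p := 2) (by norm_num)
      (by norm_num)).1 hu.eLpNorm_lt_top
    simpa using h
  have hmeas : AEMeasurable (fun p : Domain d m => ‖u p‖ₑ ^ (2 : ℝ))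
      ((volume : Measure (EuclideanSpace ℝ (Fin d))).prod (volume : Measure (Torus m))) :=
    hu.aestronglyMeasurable.enorm.pow_const _
  have hprod : ∫⁻ x : EuclideanSpace ℝ (Fin d), ∫⁻ y : Torus m, ‖u (x, y)‖ₑ ^ (2 : ℝ) < ∞ := by
    rw [← lintegral_prod _ hmeas]
    exact hfin
  simp only [ENNReal.toReal_ofNat]
  refine (lintegral_mono_ae key).trans_lt ?_
  rw [lintegral_const_mul' _ _ (measure_ne_top _ _)]
  exact ENNReal.mul_lt_top (measure_lt_top _ _) hprod

/-- The Fourier transform of `u ∈ L²(ℝ^d × 𝕋^m)`: for each `k ∈ ℤ^m`, the `L²(ℝ^d)` Fourier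
transform of the `k`-th torus coefficient of `u`. Mathlib's transform on `ℝ^d` has the kernel
`exp (-2πi x·ξ)`, so that `-Δ` acts as multiplication by `|2πξ|² + |k|²`. -/
noncomputable def fourierTransform {d m : ℕ} (u : L2 d m) (k : Fin m → ℤ) :
    Lp ℂ 2 (volume : Measure (EuclideanSpace ℝ (Fin d))) :=
  𝓕 (memLp_torusCoeff (Lp.memLp u) k).toLp

/-- The symbol `|2πξ|² + |k|²` of `-Δ` on `ℝ^d × 𝕋^m`. -/
noncomputable def laplaceSymbol {d m : ℕ} (ξ : EuclideanSpace ℝ (Fin d)) (k : Fin m → ℤ) : ℝ :=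
  (2 * Real.pi * ‖ξ‖) ^ 2 + ∑ j, (k j : ℝ) ^ 2

/-- `‖w(-Δ)^{1/2} u‖₂²`, where `w(-Δ)` is the Fourier multiplier with symbol `w(|2πξ|² + |k|²)`,
computed with Plancherel's formula
`‖u‖₂² = (2π)^m ∑_k ∫ |û(ξ, k)|² dξ`. The value is `∞` iff `u` is not in the domain of `w(-Δ)^{1/2}`. -/
noncomputable def multiplierNormSq {d m : ℕ} (w : ℝ → ℝ) (u : L2 d m) : ℝ≥0∞ :=
  ENNReal.ofReal ((2 * Real.pi) ^ m) *
    ∑' k : Fin m → ℤ, ∫⁻ ξ : EuclideanSpace ℝ (Fin d),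
      ENNReal.ofReal (w (laplaceSymbol ξ k)) * ‖fourierTransform u k ξ‖ₑ ^ 2

/-- The Sobolev space `H^σ(ℝ^d × 𝕋^m)`: all `u ∈ L²` with `‖(1 - Δ)^{σ/2} u‖₂ < ∞`. -/
def sobolev (d m : ℕ) (σ : ℝ) : Set (L2 d m) :=
  {u | multiplierNormSq (fun s => (1 + s) ^ σ) u < ∞}

/-- `‖(-Δ)^{σ/2} u‖₂²`, where `(-Δ)^{σ/2}` has the symbol `(|2πξ|² + |k|²)^{σ/2}`. -/
noncomputable def fracLaplaceNormSq {d m : ℕ} (σ : ℝ) (u : L2 d m) : ℝ≥0∞ :=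
  multiplierNormSq (fun s => s ^ σ) u

/-- The energy `E(u) = ½ ‖(-Δ)^{σ/2} u‖₂² - (α + 2)⁻¹ ‖u‖_{α+2}^{α+2}`. It takes values in the
extended reals, so that no convention about divergent integrals enters: the first term is finite
on `H^σ`, and a divergent second term would give the value `-∞`. -/
noncomputable def energy {d m : ℕ} (σ α : ℝ) (u : L2 d m) : EReal :=
  ((ENNReal.ofReal (1 / 2) * fracLaplaceNormSq σ u : ℝ≥0∞) : EReal) -
    ((ENNReal.ofReal (1 / (α + 2)) *
      ∫⁻ p : Domain d m, ‖u p‖ₑ ^ (α + 2) : ℝ≥0∞) : EReal)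

/-- The mass constraint `S(c) = {u ∈ H^σ(ℝ^d × 𝕋^m) : ‖u‖₂² = c}`. -/
def massSphere (d m : ℕ) (σ c : ℝ) : Set (L2 d m) :=
  {u | u ∈ sobolev d m σ ∧ ‖u‖ ^ 2 = c}

/-- `m_c = inf {E(u) : u ∈ S(c)}`, in the extended reals. -/
noncomputable def groundEnergy (d m : ℕ) (σ α c : ℝ) : EReal :=
  ⨅ u ∈ massSphere d m σ c, energy σ α u

end Waveguide

/-!
The proof is the direct method of the calculus of variations on the noncompact manifold
`ℝ^d × 𝕋^m`, with concentration compactness reduced to the extraction of one weak limit.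

*Coercivity.* The only analytic input about `H^σ` is that translating `u` by `|h| ≤ r` moves it by
`O(r^σ) ‖(-Δ)^{σ/2} u‖₂` in `L²` (`enorm_translate_sub_sq_le`), so the averages of `u` over balls of
radius `r` differ from `u` by the same amount. Averages are at most `O(r^{-(d+m)/2}) ‖u‖₂`; choosing `r`
according to a level `l` gives a weak-type bound for `u` above the level `l`, and summing it over dyadic
levels shows, for `α < 4σ/(d+m)`, that `‖u‖_{α+2}^{α+2} ≤ C + ε ‖(-Δ)^{σ/2} u‖₂²` on bounded sets of `L²`
(`exists_lintegral_rpow_le`). Hence the energy is bounded below on the mass sphere and controls the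
kinetic energy. No Sobolev or Gagliardo–Nirenberg embedding is needed.

*Negativity.* A Gaussian in `ℝ^d` which is constant along the torus, of width tending to infinity, has
negative energy, since `α < 4σ/(d+m) ≤ 4σ/d` (`exists_mem_massSphere_energy_neg`).

*Compactness modulo translations.* Along a minimizing sequence the kinetic energy is bounded and, as the
energies stay negative, `‖u_n‖_{α+2}` stays away from zero. The same averaging argument then produces
balls of a fixed radius on which the average of `u_n` is bounded below (`exists_le_norm_ballAverage`).
After translating these balls to the origin, a subsequence has a weak limit `v ≠ 0`
(`exists_translate_weakTendsto`).

*No loss of mass.* Put `w_n = u_n - v`. Mass and kinetic energy split because the norms are Hilbertian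
(`exists_weakTendsto_sobolev`); for the potential energy the inequality
`‖u_n‖_{α+2}^{α+2} ≤ ‖w_n‖_{α+2}^{α+2} + ‖v‖_{α+2}^{α+2} + o(1)` suffices
(`eventually_potential_add_le`), and it follows from Fatou's lemma because `w_n → 0` almost everywhere
along a subsequence (`exists_subseq_ae_tendsto_zero`). On the other hand, multiplication of `u` by a
scalar shows that a function of mass `a ≤ c` has energy at least `(a / c) m_c`, strictly more if
`0 < a < c` (`mul_le_realEnergy`, `mul_lt_realEnergy`). Applied to `w_n`, this bounds the energy of `v` by
`(‖v‖₂² / c) m_c`; applied to `v`, it forces `‖v‖₂² = c`, and `v` is a minimizer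
(`exists_realEnergy_eq`).
-/

namespace Waveguide

/-! ### Parseval's identity on the torus -/

instance isAddHaarMeasure_domain (d m : ℕ) :
    (volume : Measure (Domain d m)).IsAddHaarMeasure :=
  Measure.prod.instIsAddHaarMeasure (volume : Measure (EuclideanSpace ℝ (Fin d)))
    (volume : Measure (Torus m))

instance sigmaFinite_domain (d m : ℕ) : SigmaFinite (volume : Measure (Domain d m)) :=
  inferInstanceAs (SigmaFinite ((volume : Measure (EuclideanSpace ℝ (Fin d))).prod
    (volume : Measure (Torus m))))

theorem volume_torus_univ (m : ℕ) :
    volume (Set.univ : Set (Torus m)) = ENNReal.ofReal ((2 * Real.pi) ^ m) := by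
  rw [volume_pi, Measure.pi_univ]
  simp [AddCircle.measure_univ, ENNReal.ofReal_pow Real.two_pi_pos.le]

/-- The dilation `y ↦ 2πy` from the unit torus onto `𝕋^m`. -/
noncomputable def torusDilation (m : ℕ) : UnitAddTorus (Fin m) ≃+ Torus m :=
  AddEquiv.piCongrRight fun _ =>
    AddCircle.equivAddCircle 1 (2 * Real.pi) one_ne_zero Real.two_pi_pos.ne'

theorem continuous_torusDilation (m : ℕ) : Continuous (torusDilation m) :=
  continuous_pi fun j => (AddCircle.homeomorphAddCircle 1 (2 * Real.pi) one_ne_zero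
    Real.two_pi_pos.ne').continuous.comp (continuous_apply j)

theorem continuous_torusDilation_symm (m : ℕ) : Continuous (torusDilation m).symm :=
  continuous_pi fun j => (AddCircle.homeomorphAddCircle 1 (2 * Real.pi) one_ne_zero
    Real.two_pi_pos.ne').symm.continuous.comp (continuous_apply j)

theorem torusChar_torusDilation {m : ℕ} (k : Fin m → ℤ) (y : UnitAddTorus (Fin m)) :
    torusChar k (torusDilation m y) = UnitAddTorus.mFourier k y := by
  simp only [torusChar, UnitAddTorus.mFourier, ContinuousMap.coe_mk]
  refine Finset.prod_congr rfl fun j _ => ?_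
  change fourier (k j) (AddCircle.equivAddCircle 1 (2 * Real.pi) one_ne_zero
    Real.two_pi_pos.ne' (y j)) = _
  induction y j using QuotientAddGroup.induction_on with
  | H z =>
    rw [AddCircle.equivAddCircle_apply_mk, fourier_coe_apply, fourier_coe_apply]
    congr 1
    have : (Real.pi : ℂ) ≠ 0 := by exact_mod_cast Real.pi_ne_zero
    push_cast
    field_simp

local notation "haarTorus" => (Measure.pi fun _ => AddCircle.haarAddCircle)

theorem volume_torus_eq_smul_map (m : ℕ) :
    (volume : Measure (Torus m)) = ENNReal.ofReal ((2 * Real.pi) ^ m) •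
      (haarTorus : Measure (UnitAddTorus (Fin m))).map (torusDilation m) := by
  set μ := (haarTorus : Measure (UnitAddTorus (Fin m))).map (torusDilation m) with hμ
  have : μ.IsAddHaarMeasure := (torusDilation m).isAddHaarMeasure_map _
    (continuous_torusDilation m) (continuous_torusDilation_symm m)
  have h := Measure.isAddLeftInvariant_eq_smul (volume : Measure (Torus m)) μ
  have hu : μ Set.univ = 1 := by
    rw [hμ, Measure.map_apply (continuous_torusDilation m).measurable MeasurableSet.univ]
    simp
  have h2 := congrArg (fun ν : Measure (Torus m) => ν Set.univ) h
  simp only [Measure.smul_apply, hu, volume_torus_univ] at h2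
  rw [ENNReal.smul_def, smul_eq_mul, mul_one] at h2
  rw [h2]
  exact h

/-- Parseval's identity on `𝕋^m`. -/
theorem tsum_enorm_sq_torusChar_integral {m : ℕ} {f : Torus m → ℂ} (hf : MemLp f 2) :
    ∑' k : Fin m → ℤ, ‖∫ y : Torus m, torusChar (-k) y * f y‖ₑ ^ 2 =
      ENNReal.ofReal ((2 * Real.pi) ^ m) * ∫⁻ y : Torus m, ‖f y‖ₑ ^ 2 := by
  set μ := (haarTorus : Measure (UnitAddTorus (Fin m))) with hμ
  have hpos : 0 < (2 * Real.pi) ^ m := pow_pos Real.two_pi_pos m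
  have hmeas := (continuous_torusDilation m).measurable
  have hmp : MeasurePreserving (torusDilation m) μ (μ.map (torusDilation m)) :=
    ⟨hmeas, rfl⟩
  have hemb : MeasurableEmbedding (torusDilation m) :=
    ((torusDilation m).toEquiv.toHomeomorphOfContinuousOpen (continuous_torusDilation m)
      (fun s hs => by
        have := hs.preimage (continuous_torusDilation_symm m)
        rwa [← AddEquiv.coe_toEquiv_symm, ← Equiv.image_eq_preimage_symm] at this)
      ).measurableEmbedding
  have hac : (μ.map (torusDilation m)) ≪ volume := by
    rw [volume_torus_eq_smul_map]
    exact Measure.absolutelyContinuous_smul (by simpa using hpos)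
  have hcne : ENNReal.ofReal ((2 * Real.pi) ^ m) ≠ 0 := by simpa using hpos
  have hmap : μ.map (torusDilation m) = (ENNReal.ofReal ((2 * Real.pi) ^ m))⁻¹ • volume := by
    rw [volume_torus_eq_smul_map, smul_smul, ENNReal.inv_mul_cancel hcne ENNReal.ofReal_ne_top,
      one_smul]
  have hg : MemLp (fun y => f (torusDilation m y)) 2 μ := by
    have h1 : MemLp f 2 (μ.map (torusDilation m)) := by
      rw [hmap]
      exact hf.smul_measure (by simpa using hpos)
    exact h1.comp_measurePreserving hmp
  have hint : ∀ k : Fin m → ℤ, ∫ y : Torus m, torusChar (-k) y * f y =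
      ((2 * Real.pi) ^ m : ℝ) • UnitAddTorus.mFourierCoeff (fun y => f (torusDilation m y)) k := by
    intro k
    rw [volume_torus_eq_smul_map, integral_smul_measure, hemb.integral_map,
      ENNReal.toReal_ofReal hpos.le]
    congr 1
    refine integral_congr_ae (.of_forall fun y => ?_)
    simp [torusChar_torusDilation]
  have hsum := UnitAddTorus.hasSum_sq_mFourierCoeff hg.toLp
  have hcoeff : ∀ k, UnitAddTorus.mFourierCoeff hg.toLp k =
      UnitAddTorus.mFourierCoeff (fun y => f (torusDilation m y)) k := fun k =>
    integral_congr_ae (by filter_upwards [hg.coeFn_toLp] with y hy; rw [hy])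
  simp only [hcoeff] at hsum
  have hL : ∫⁻ y : Torus m, ‖f y‖ₑ ^ 2 = ENNReal.ofReal ((2 * Real.pi) ^ m) *
      ∫⁻ y, ‖f (torusDilation m y)‖ₑ ^ 2 ∂μ := by
    rw [volume_torus_eq_smul_map, lintegral_smul_measure, hemb.lintegral_map, smul_eq_mul]
  have hR : ∫⁻ y, ‖f (torusDilation m y)‖ₑ ^ 2 ∂μ =
      ENNReal.ofReal (∫ y, ‖(hg.toLp : UnitAddTorus (Fin m) → ℂ) y‖ ^ 2 ∂μ) := by
    rw [ofReal_integral_eq_lintegral_ofReal]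
    · refine lintegral_congr_ae ?_
      filter_upwards [hg.coeFn_toLp] with y hy
      rw [hy, ENNReal.ofReal_pow (norm_nonneg _), ofReal_norm]
    · exact (Lp.memLp hg.toLp).integrable_norm_pow (by norm_num)
    · exact .of_forall fun y => by positivity
  have hS : ∑' k, ENNReal.ofReal (‖UnitAddTorus.mFourierCoeff
      (fun y => f (torusDilation m y)) k‖ ^ 2) = ∫⁻ y, ‖f (torusDilation m y)‖ₑ ^ 2 ∂μ := by
    rw [hR]
    exact (ENNReal.ofReal_tsum_of_nonneg (fun _ => by positivity) hsum.summable).symm.trans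
      (congrArg ENNReal.ofReal hsum.tsum_eq)
  rw [hL, ← hS, ← ENNReal.tsum_mul_left, ← ENNReal.tsum_mul_left]
  refine tsum_congr fun k => ?_
  rw [hint, enorm_smul, Real.enorm_of_nonneg hpos.le, ENNReal.ofReal_pow (norm_nonneg _),
    ofReal_norm]
  ring

/-! ### The Fourier transform and translations on `L²(ℝ^d)` -/

section FourierL2

open scoped SchwartzMap

variable {V : Type*} [NormedAddCommGroup V] [InnerProductSpace ℝ V] [FiniteDimensional ℝ V]
  [MeasurableSpace V] [BorelSpace V]

/-- The `L²` Fourier transform agrees with the Fourier integral on `L¹ ∩ L²`. -/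
theorem fourier_toLp_of_integrable {f : V → ℂ} (hf1 : Integrable f) (hf : MemLp f 2)
    (hF : MemLp (𝓕 f) 2) : 𝓕 hf.toLp = hF.toLp := by
  have hinj := LinearMap.ker_eq_bot.1
    (Lp.ker_toTemperedDistributionCLM_eq_bot (E := V) (F := ℂ) (μ := volume) (p := 2))
  apply hinj
  change Lp.toTemperedDistribution (𝓕 hf.toLp) = Lp.toTemperedDistribution hF.toLp
  rw [← Lp.fourier_toTemperedDistribution_eq]
  ext g
  rw [TemperedDistribution.fourier_apply, Lp.toTemperedDistribution_apply,
    Lp.toTemperedDistribution_apply]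
  have h1 : ∫ x, (𝓕 g) x • (hf.toLp : V → ℂ) x = ∫ x, 𝓕 (g : V → ℂ) x • f x := by
    refine integral_congr_ae ?_
    filter_upwards [hf.coeFn_toLp] with x hx
    rw [hx, SchwartzMap.fourier_coe]
  have h2 : ∫ x, g x • (hF.toLp : V → ℂ) x = ∫ x, g x • 𝓕 f x := by
    refine integral_congr_ae ?_
    filter_upwards [hF.coeFn_toLp] with x hx
    rw [hx]
  rw [h1, h2]
  have := VectorFourier.integral_fourierIntegral_smul_eq_flip (L := innerₗ V)
    (μ := volume) (ν := volume) Real.continuous_fourierChar continuous_inner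
    (g.integrable (μ := volume)) hf1
  rw [flip_innerₗ] at this
  exact this

/-- Translation by `a` on `L²`, namely `f ↦ f (· + a)`. -/
noncomputable def translateₗᵢ (a : V) :
    Lp ℂ 2 (volume : Measure V) →ₗᵢ[ℂ] Lp ℂ 2 (volume : Measure V) :=
  Lp.compMeasurePreservingₗᵢ ℂ (· + a) (measurePreserving_add_right volume a)

/-- Multiplication of `L²` functions by a bounded measurable function. -/
theorem exists_continuousLinearMap_mul {α : Type*} [MeasurableSpace α] {μ : Measure α} {e : α → ℂ}
    (he : MemLp e ∞ μ) :
    ∃ T : Lp ℂ 2 μ →L[ℂ] Lp ℂ 2 μ, ∀ f, T f =ᵐ[μ] fun x => e x * f x := by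
  refine ⟨(ContinuousLinearMap.mul ℂ ℂ).holderL μ ∞ 2 2 he.toLp, fun f => ?_⟩
  have h := (ContinuousLinearMap.mul ℂ ℂ).coeFn_holder (r := 2) he.toLp f
  filter_upwards [h, he.coeFn_toLp] with x hx hx2
  rw [← hx2]
  exact hx

/-- Translation by `a` becomes multiplication by the character `ξ ↦ exp (2πi ⟨a, ξ⟩)`. Both sides are
continuous in `f`, so it is enough to compare Fourier integrals of Schwartz functions. -/
theorem fourier_translate_ae (a : V) (f : Lp ℂ 2 (volume : Measure V)) :
    (𝓕 (translateₗᵢ a f) : Lp ℂ 2 (volume : Measure V)) =ᵐ[volume]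
      fun ξ => (Real.fourierChar (inner ℝ a ξ) : ℂ) * (𝓕 f : Lp ℂ 2 (volume : Measure V)) ξ := by
  set e : V → ℂ := fun ξ => (Real.fourierChar (inner ℝ a ξ) : ℂ) with he
  have hec : Continuous e := by
    have : Continuous fun ξ : V => Real.fourierChar (inner ℝ a ξ) :=
      Real.continuous_fourierChar.comp (by fun_prop)
    fun_prop
  have hmem : MemLp e ∞ (volume : Measure V) :=
    memLp_top_of_bound hec.aestronglyMeasurable 1
      (.of_forall fun ξ => (Circle.norm_coe _).le)
  obtain ⟨T, hT⟩ := exists_continuousLinearMap_mul hmem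
  suffices h : 𝓕 (translateₗᵢ a f) = T (𝓕 f) by
    rw [h]
    exact hT _
  refine DenseRange.induction_on
    (p := fun f : Lp ℂ 2 (volume : Measure V) => 𝓕 (translateₗᵢ a f) = T (𝓕 f))
    (SchwartzMap.denseRange_toLpCLM (F := ℂ) (p := 2) (μ := (volume : Measure V))
      ENNReal.ofNat_ne_top) f ?_ ?_
  · refine isClosed_eq ?_ ?_
    · exact (Lp.fourierTransformₗᵢ V ℂ).continuous.comp (translateₗᵢ a).continuous
    · exact T.continuous.comp (Lp.fourierTransformₗᵢ V ℂ).continuous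
  · intro g
    change 𝓕 (translateₗᵢ a (g.toLp 2)) = T (𝓕 (g.toLp 2))
    have hmp := measurePreserving_add_right (volume : Measure V) a
    have hg2 : MemLp (fun x => g (x + a)) 2 (volume : Measure V) :=
      (g.memLp 2 volume).comp_measurePreserving hmp
    have hg1 : Integrable (fun x => g (x + a)) (volume : Measure V) := g.integrable.comp_add_right a
    have hF : 𝓕 (fun x => g (x + a)) = fun ξ => e ξ * (𝓕 g) ξ := by
      have := VectorFourier.fourierIntegral_comp_add_right Real.fourierChar
        (volume : Measure V) (innerₗ V) g a
      refine this.trans ?_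
      funext ξ
      rw [SchwartzMap.fourier_coe, Circle.smul_def]
      rfl
    have hFm : MemLp (𝓕 (fun x => g (x + a))) 2 (volume : Measure V) := by
      rw [hF]
      exact MemLp.of_le ((𝓕 g).memLp 2 volume)
        (hec.aestronglyMeasurable.mul (𝓕 g).continuous.aestronglyMeasurable)
        (.of_forall fun ξ => by
          have : ‖e ξ‖ = 1 := Circle.norm_coe _
          rw [norm_mul, this, one_mul])
    have h1 : translateₗᵢ a (g.toLp 2) = hg2.toLp := by
      ext1
      refine (Lp.coeFn_compMeasurePreserving _ hmp).trans ?_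
      exact (hmp.quasiMeasurePreserving.ae_eq_comp (g.coeFn_toLp 2 volume)).trans
        hg2.coeFn_toLp.symm
    rw [h1, fourier_toLp_of_integrable hg1 hg2 hFm, SchwartzMap.toLp_fourier_eq]
    ext1
    refine hFm.coeFn_toLp.trans ?_
    filter_upwards [hT ((𝓕 g).toLp 2), (𝓕 g).coeFn_toLp 2 volume] with ξ h2 h3
    rw [h2, h3, hF]

end FourierL2

/-! ### Plancherel's theorem and translations on `ℝ^d × 𝕋^m` -/

variable {d m : ℕ}

theorem lintegral_enorm_sq_eq {α : Type*} [MeasurableSpace α] {μ : Measure α} (f : Lp ℂ 2 μ) :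
    ∫⁻ x, ‖f x‖ₑ ^ 2 ∂μ = ‖f‖ₑ ^ 2 := by
  rw [Lp.enorm_def, eLpNorm_eq_lintegral_rpow_enorm_toReal (by norm_num) (by norm_num)]
  simp only [ENNReal.toReal_ofNat, ENNReal.rpow_ofNat]
  rw [← ENNReal.rpow_natCast, ← ENNReal.rpow_mul]
  norm_num

theorem lintegral_enorm_sq_lt_top {α : Type*} [MeasurableSpace α] {μ : Measure α} {f : α → ℂ}
    (hf : MemLp f 2 μ) : ∫⁻ x, ‖f x‖ₑ ^ 2 ∂μ < ∞ := by
  have h := (eLpNorm_lt_top_iff_lintegral_rpow_enorm_lt_top (p := 2) (by norm_num)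
    (by norm_num)).1 hf.eLpNorm_lt_top
  simpa using h

theorem memLp_two_of_lintegral_enorm_sq_lt_top {α : Type*} [MeasurableSpace α] {μ : Measure α}
    {f : α → ℂ} (hf : AEStronglyMeasurable f μ) (h : ∫⁻ x, ‖f x‖ₑ ^ 2 ∂μ < ∞) : MemLp f 2 μ :=
  ⟨hf, (eLpNorm_lt_top_iff_lintegral_rpow_enorm_lt_top (by norm_num) (by norm_num)).2
    (by simpa using h)⟩

theorem volume_domain_eq : (volume : Measure (Domain d m)) =
    (volume : Measure (EuclideanSpace ℝ (Fin d))).prod (volume : Measure (Torus m)) := rfl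

/-- Almost every torus slice of an `L²` function is in `L²(𝕋^m)`. -/
theorem ae_memLp_slice {u : Domain d m → ℂ} (hu : MemLp u 2) :
    ∀ᵐ x : EuclideanSpace ℝ (Fin d), MemLp (fun y : Torus m => u (x, y)) 2 := by
  have hmeas : AEMeasurable (fun p : Domain d m => ‖u p‖ₑ ^ 2)
      ((volume : Measure (EuclideanSpace ℝ (Fin d))).prod (volume : Measure (Torus m))) :=
    hu.aestronglyMeasurable.enorm.pow_const _
  have hfin := lintegral_enorm_sq_lt_top hu
  rw [volume_domain_eq, lintegral_prod _ hmeas] at hfin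
  filter_upwards [hu.aestronglyMeasurable.prodMk_left,
    ae_lt_top' hmeas.lintegral_prod_right' hfin.ne] with x hx hx2
  exact memLp_two_of_lintegral_enorm_sq_lt_top hx hx2

theorem torusCoeff_congr_ae {u v : Domain d m → ℂ} (h : u =ᵐ[volume] v) (k : Fin m → ℤ) :
    torusCoeff u k =ᵐ[volume] torusCoeff v k := by
  have h' := Measure.ae_ae_of_ae_prod (μ := (volume : Measure (EuclideanSpace ℝ (Fin d))))
    (ν := (volume : Measure (Torus m))) h
  filter_upwards [h'] with x hx
  unfold torusCoeff
  congr 1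
  refine integral_congr_ae ?_
  filter_upwards [hx] with y hy
  rw [hy]

theorem integrable_torusChar_mul {f : Torus m → ℂ} (hf : MemLp f 2) (k : Fin m → ℤ) :
    Integrable (fun y => torusChar k y * f y) :=
  (hf.integrable (by norm_num)).bdd_mul (c := 1)
    (continuous_torusChar k).aestronglyMeasurable (.of_forall fun y => (norm_torusChar k y).le)

/-- The `k`-th torus coefficient as an element of `L²(ℝ^d)`. -/
noncomputable def torusCoeffLp (u : L2 d m) (k : Fin m → ℤ) :
    Lp ℂ 2 (volume : Measure (EuclideanSpace ℝ (Fin d))) :=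
  (memLp_torusCoeff (Lp.memLp u) k).toLp

theorem torusCoeffLp_ae (u : L2 d m) (k : Fin m → ℤ) :
    torusCoeffLp u k =ᵐ[volume] torusCoeff u k := MemLp.coeFn_toLp _

theorem torusCoeffLp_add (u v : L2 d m) (k : Fin m → ℤ) :
    torusCoeffLp (u + v) k = torusCoeffLp u k + torusCoeffLp v k := by
  ext1
  filter_upwards [torusCoeffLp_ae (u + v) k, Lp.coeFn_add (torusCoeffLp u k) (torusCoeffLp v k),
    torusCoeffLp_ae u k, torusCoeffLp_ae v k, torusCoeff_congr_ae (Lp.coeFn_add u v) k,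
    ae_memLp_slice (Lp.memLp u), ae_memLp_slice (Lp.memLp v)] with x h1 h2 h3 h4 h5 h6 h7
  rw [h1, h2, Pi.add_apply, h3, h4, h5]
  simp only [torusCoeff, Pi.add_apply, mul_add]
  rw [integral_add (integrable_torusChar_mul h6 _) (integrable_torusChar_mul h7 _), smul_add]

theorem torusCoeffLp_smul (c : ℂ) (u : L2 d m) (k : Fin m → ℤ) :
    torusCoeffLp (c • u) k = c • torusCoeffLp u k := by
  ext1
  filter_upwards [torusCoeffLp_ae (c • u) k, Lp.coeFn_smul c (torusCoeffLp u k),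
    torusCoeffLp_ae u k, torusCoeff_congr_ae (Lp.coeFn_smul c u) k] with x h1 h2 h3 h5
  rw [h1, h2, Pi.smul_apply, h3, h5]
  simp only [torusCoeff, Pi.smul_apply, smul_eq_mul, mul_left_comm _ c]
  rw [integral_const_mul]
  exact (mul_smul_comm _ _ _).symm

theorem fourierTransform_eq (u : L2 d m) (k : Fin m → ℤ) :
    fourierTransform u k = Lp.fourierTransformₗᵢ _ ℂ (torusCoeffLp u k) := rfl

theorem fourierTransform_add (u v : L2 d m) (k : Fin m → ℤ) :
    fourierTransform (u + v) k = fourierTransform u k + fourierTransform v k := by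
  simp only [fourierTransform_eq, torusCoeffLp_add, map_add]

theorem fourierTransform_smul (c : ℂ) (u : L2 d m) (k : Fin m → ℤ) :
    fourierTransform (c • u) k = c • fourierTransform u k := by
  simp only [fourierTransform_eq, torusCoeffLp_smul, map_smul]

theorem fourierTransform_sub (u v : L2 d m) (k : Fin m → ℤ) :
    fourierTransform (u - v) k = fourierTransform u k - fourierTransform v k := by
  rw [eq_sub_iff_add_eq, ← fourierTransform_add, sub_add_cancel]

/-- Plancherel's theorem on `ℝ^d × 𝕋^m`. -/
theorem plancherel (u : L2 d m) :
    ENNReal.ofReal ((2 * Real.pi) ^ m) * ∑' k : Fin m → ℤ,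
      ∫⁻ ξ : EuclideanSpace ℝ (Fin d), ‖fourierTransform u k ξ‖ₑ ^ 2 = ‖u‖ₑ ^ 2 := by
  have hpos : 0 < (2 * Real.pi) ^ m := pow_pos Real.two_pi_pos m
  have hk : ∀ k : Fin m → ℤ, ∫⁻ ξ : EuclideanSpace ℝ (Fin d), ‖fourierTransform u k ξ‖ₑ ^ 2 =
      ∫⁻ x, ‖torusCoeff u k x‖ₑ ^ 2 := by
    intro k
    rw [lintegral_enorm_sq_eq, fourierTransform_eq, LinearIsometryEquiv.enorm_map,
      ← lintegral_enorm_sq_eq]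
    refine lintegral_congr_ae ?_
    filter_upwards [torusCoeffLp_ae u k] with x hx
    rw [hx]
  have hmeas : AEMeasurable (fun p : Domain d m => ‖u p‖ₑ ^ 2)
      ((volume : Measure (EuclideanSpace ℝ (Fin d))).prod (volume : Measure (Torus m))) :=
    (Lp.aestronglyMeasurable u).enorm.pow_const _
  simp only [hk]
  rw [← lintegral_tsum fun k =>
    (memLp_torusCoeff (Lp.memLp u) k).aestronglyMeasurable.enorm.pow_const _,
    ← lintegral_const_mul' _ _ ENNReal.ofReal_ne_top, ← lintegral_enorm_sq_eq]
  refine Eq.trans ?_ (lintegral_prod _ hmeas).symm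
  refine lintegral_congr_ae ?_
  filter_upwards [ae_memLp_slice (Lp.memLp u)] with x hx
  have h := tsum_enorm_sq_torusChar_integral hx
  have h2 : ∀ k, ‖torusCoeff u k x‖ₑ ^ 2 = (ENNReal.ofReal (((2 * Real.pi) ^ m)⁻¹)) ^ 2 *
      ‖∫ y : Torus m, torusChar (-k) y * u (x, y)‖ₑ ^ 2 := by
    intro k
    rw [torusCoeff, enorm_smul, Real.enorm_of_nonneg (inv_pos.2 hpos).le, mul_pow]
  simp only [h2]
  rw [ENNReal.tsum_mul_left, h, ← mul_assoc, ← mul_assoc, ← ENNReal.ofReal_pow (inv_pos.2 hpos).le,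
    ← ENNReal.ofReal_mul hpos.le, ← ENNReal.ofReal_mul (by positivity)]
  have : (2 * Real.pi) ^ m * (((2 * Real.pi) ^ m)⁻¹) ^ 2 * (2 * Real.pi) ^ m = 1 := by
    field_simp
  rw [this, ENNReal.ofReal_one, one_mul]

/-- Translation `u ↦ u (· + h)` on `L²(ℝ^d × 𝕋^m)`. -/
noncomputable def translate (h : Domain d m) : L2 d m →ₗᵢ[ℂ] L2 d m :=
  Lp.compMeasurePreservingₗᵢ ℂ (· + h) (measurePreserving_add_right volume h)

theorem translate_ae (h : Domain d m) (u : L2 d m) :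
    translate h u =ᵐ[volume] fun p => u (p + h) :=
  Lp.coeFn_compMeasurePreserving _ (measurePreserving_add_right volume h)

/-- The factor by which translation by `h` multiplies the Fourier transform. -/
noncomputable def phase (h : Domain d m) (k : Fin m → ℤ) (ξ : EuclideanSpace ℝ (Fin d)) : ℂ :=
  torusChar k h.2 * Real.fourierChar (inner ℝ h.1 ξ)

theorem norm_phase (h : Domain d m) (k : Fin m → ℤ) (ξ : EuclideanSpace ℝ (Fin d)) :
    ‖phase h k ξ‖ = 1 := by
  rw [phase, norm_mul, norm_torusChar, Circle.norm_coe, one_mul]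

theorem torusChar_add (k : Fin m → ℤ) (y z : Torus m) :
    torusChar k (y + z) = torusChar k y * torusChar k z := by
  simp only [torusChar, ← Finset.prod_mul_distrib]
  refine Finset.prod_congr rfl fun j _ => ?_
  simp only [Pi.add_apply, fourier_apply, smul_add, AddCircle.toCircle_add, Circle.coe_mul]

theorem torusChar_neg_mul (k : Fin m → ℤ) (y : Torus m) :
    torusChar (-k) y * torusChar k y = 1 := by
  simp only [torusChar, ← Finset.prod_mul_distrib]
  refine Finset.prod_eq_one fun j _ => ?_
  rw [Pi.neg_apply, ← fourier_add, neg_add_cancel, fourier_zero]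

theorem torusCoeffLp_translate (h : Domain d m) (u : L2 d m) (k : Fin m → ℤ) :
    torusCoeffLp (translate h u) k =
      torusChar k h.2 • translateₗᵢ h.1 (torusCoeffLp u k) := by
  have hmp := measurePreserving_add_right (volume : Measure (EuclideanSpace ℝ (Fin d))) h.1
  ext1
  filter_upwards [torusCoeffLp_ae (translate h u) k, torusCoeff_congr_ae (translate_ae h u) k,
    Lp.coeFn_smul (torusChar k h.2) (translateₗᵢ h.1 (torusCoeffLp u k)),
    Lp.coeFn_compMeasurePreserving (torusCoeffLp u k) hmp,
    hmp.quasiMeasurePreserving.ae_eq_comp (torusCoeffLp_ae u k)] with x h1 h2 h3 h4 h5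
  rw [h1, h2, h3, Pi.smul_apply]
  change _ = torusChar k h.2 • (Lp.compMeasurePreserving _ hmp (torusCoeffLp u k) :
    EuclideanSpace ℝ (Fin d) → ℂ) x
  rw [h4, h5]
  simp only [torusCoeff, Function.comp_apply]
  rw [smul_comm]
  congr 1
  rw [smul_eq_mul, ← integral_add_right_eq_self (fun y => torusChar (-k) y * u (x + h.1, y)) h.2,
    ← integral_const_mul]
  refine integral_congr_ae (.of_forall fun y => ?_)
  have := (mul_comm _ _).trans (torusChar_neg_mul k h.2)
  simp only [torusChar_add]
  rw [← mul_assoc, ← mul_assoc, mul_comm (torusChar k h.2), mul_assoc (torusChar (-k) y), this,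
    mul_one]
  rfl

theorem fourierTransform_translate_ae (h : Domain d m) (u : L2 d m) (k : Fin m → ℤ) :
    fourierTransform (translate h u) k =ᵐ[volume]
      fun ξ => phase h k ξ * fourierTransform u k ξ := by
  rw [fourierTransform_eq, torusCoeffLp_translate, map_smul]
  filter_upwards [Lp.coeFn_smul (torusChar k h.2) (Lp.fourierTransformₗᵢ _ ℂ
    (translateₗᵢ h.1 (torusCoeffLp u k))), fourier_translate_ae h.1 (torusCoeffLp u k)]
    with ξ h1 h2
  rw [h1, Pi.smul_apply, smul_eq_mul, phase, mul_assoc]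
  congr 1

/-! ### Translation estimates in `H^σ` -/

theorem norm_fourier_sub_one_le (n : ℤ) (y : AddCircle (2 * Real.pi)) :
    ‖fourier n y - 1‖ ≤ |(n : ℝ)| * ‖y‖ := by
  have hpi : (Real.pi : ℂ) ≠ 0 := by exact_mod_cast Real.pi_ne_zero
  obtain ⟨x, rfl, hx⟩ : ∃ x : ℝ, (x : AddCircle (2 * Real.pi)) = y ∧ ‖y‖ = |x| := by
    induction y using QuotientAddGroup.induction_on with
    | H z =>
      refine ⟨z - round ((2 * Real.pi)⁻¹ * z) * (2 * Real.pi), ?_, AddCircle.norm_eq _⟩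
      rw [← zsmul_eq_mul, AddCircle.coe_sub, AddCircle.coe_zsmul, AddCircle.coe_period, smul_zero,
        sub_zero]
  have : 2 * Real.pi * Complex.I * n * x / ((2 * Real.pi : ℝ) : ℂ) =
      Complex.I * ((n * x : ℝ) : ℂ) := by
    push_cast
    field_simp
  rw [fourier_coe_apply, this, hx, ← abs_mul]
  exact Real.norm_exp_I_mul_ofReal_sub_one_le

theorem norm_prod_sub_one_le_sum {ι : Type*} (s : Finset ι) (a : ι → ℂ) (ha : ∀ i, ‖a i‖ ≤ 1) :
    ‖∏ i ∈ s, a i - 1‖ ≤ ∑ i ∈ s, ‖a i - 1‖ := by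
  classical
  induction s using Finset.induction_on with
  | empty => simp
  | insert i s hi ih =>
    rw [Finset.prod_insert hi, Finset.sum_insert hi]
    have h : a i * ∏ j ∈ s, a j - 1 = (a i - 1) + a i * (∏ j ∈ s, a j - 1) := by ring
    rw [h]
    refine (norm_add_le _ _).trans (add_le_add le_rfl ?_)
    rw [norm_mul]
    exact (mul_le_of_le_one_left (norm_nonneg _) (ha i)).trans ih

theorem norm_phase_sub_one_le (h : Domain d m) (k : Fin m → ℤ) (ξ : EuclideanSpace ℝ (Fin d)) :
    ‖phase h k ξ - 1‖ ≤ ‖h‖ * (2 * Real.pi * ‖ξ‖ + ∑ j, |(k j : ℝ)|) := by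
  have h1 : ‖torusChar k h.2 - 1‖ ≤ ‖h‖ * ∑ j, |(k j : ℝ)| := by
    refine (norm_prod_sub_one_le_sum _ _ fun j => ?_).trans ?_
    · rw [fourier_apply, Circle.norm_coe]
    · rw [Finset.mul_sum]
      refine Finset.sum_le_sum fun j _ => (norm_fourier_sub_one_le _ _).trans ?_
      rw [mul_comm]
      gcongr
      exact (norm_le_pi_norm h.2 j).trans (norm_snd_le h)
  have h2 : ‖(Real.fourierChar (inner ℝ h.1 ξ) : ℂ) - 1‖ ≤ ‖h‖ * (2 * Real.pi * ‖ξ‖) := by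
    rw [Real.fourierChar_apply, mul_comm]
    refine Real.norm_exp_I_mul_ofReal_sub_one_le.trans ?_
    rw [Real.norm_eq_abs, abs_mul, abs_of_pos Real.two_pi_pos, mul_left_comm]
    gcongr
    exact (abs_real_inner_le_norm _ _).trans (by gcongr; exact norm_fst_le h)
  have h3 : phase h k ξ - 1 = torusChar k h.2 * ((Real.fourierChar (inner ℝ h.1 ξ) : ℂ) - 1) +
      (torusChar k h.2 - 1) := by rw [phase]; ring
  rw [h3]
  refine (norm_add_le _ _).trans ?_
  rw [norm_mul, norm_torusChar, one_mul, mul_add]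
  exact add_le_add h2 h1

theorem laplaceSymbol_nonneg (ξ : EuclideanSpace ℝ (Fin d)) (k : Fin m → ℤ) :
    0 ≤ laplaceSymbol ξ k := by
  unfold laplaceSymbol
  positivity

theorem sq_add_sum_le (ξ : EuclideanSpace ℝ (Fin d)) (k : Fin m → ℤ) :
    (2 * Real.pi * ‖ξ‖ + ∑ j, |(k j : ℝ)|) ^ 2 ≤ (m + 1) * laplaceSymbol ξ k := by
  have h := sq_sum_le_card_mul_sum_sq (s := (Finset.univ : Finset (Option (Fin m))))
    (f := fun o => o.elim (2 * Real.pi * ‖ξ‖) fun j => |(k j : ℝ)|)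
  simpa [Fintype.sum_option, laplaceSymbol] using h

/-- Interpolation between `|exp (iθ) - 1| ≤ |θ|` for low frequencies and `|exp (iθ) - 1| ≤ 2` for high
frequencies. -/
theorem norm_phase_sub_one_sq_le {σ : ℝ} (hσ0 : 0 < σ) (hσ1 : σ < 1) {r : ℝ} (h : Domain d m)
    (hr : ‖h‖ ≤ r) (k : Fin m → ℤ) (ξ : EuclideanSpace ℝ (Fin d)) :
    ‖phase h k ξ - 1‖ ^ 2 ≤ 4 * ((m + 1) * r ^ 2) ^ σ * laplaceSymbol ξ k ^ σ := by
  have hs := laplaceSymbol_nonneg ξ k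
  set t : ℝ := ((m + 1) * r ^ 2) * laplaceSymbol ξ k with ht
  have ht0 : 0 ≤ t := by positivity
  rw [mul_assoc, ← Real.mul_rpow (by positivity) hs, ← ht]
  have h1 : ‖phase h k ξ - 1‖ ^ 2 ≤ t := by
    have h0 : 0 ≤ 2 * Real.pi * ‖ξ‖ + ∑ j, |(k j : ℝ)| := by positivity
    calc ‖phase h k ξ - 1‖ ^ 2
        ≤ (r * (2 * Real.pi * ‖ξ‖ + ∑ j, |(k j : ℝ)|)) ^ 2 := by
          gcongr
          exact (norm_phase_sub_one_le h k ξ).trans (by gcongr)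
      _ ≤ t := by
          have ht' : t = r ^ 2 * ((m + 1) * laplaceSymbol ξ k) := by rw [ht]; ring
          rw [mul_pow, ht']
          exact mul_le_mul_of_nonneg_left (sq_add_sum_le ξ k) (sq_nonneg r)
  have h2 : ‖phase h k ξ - 1‖ ^ 2 ≤ 4 := by
    have : ‖phase h k ξ - 1‖ ≤ 2 := by
      refine (norm_sub_le _ _).trans ?_
      rw [norm_phase, norm_one]
      norm_num
    nlinarith [norm_nonneg (phase h k ξ - 1)]
  rcases le_total t 1 with h | h
  · have : t ≤ t ^ σ := by
      simpa using Real.rpow_le_rpow_of_exponent_ge' ht0 h hσ0.le hσ1.le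
    have := Real.rpow_nonneg ht0 σ
    linarith
  · have := Real.one_le_rpow h hσ0.le
    linarith

/-- Fractional smoothness measured by translations:
`‖u(· + h) - u‖₂² ≤ C r^{2σ} ‖(-Δ)^{σ/2} u‖₂²` for `|h| ≤ r`. -/
theorem enorm_translate_sub_sq_le {σ : ℝ} (hσ0 : 0 < σ) (hσ1 : σ < 1) {r : ℝ} (h : Domain d m)
    (hr : ‖h‖ ≤ r) (u : L2 d m) :
    ‖translate h u - u‖ₑ ^ 2 ≤
      ENNReal.ofReal (4 * ((m + 1) * r ^ 2) ^ σ) * fracLaplaceNormSq σ u := by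
  rw [← plancherel, fracLaplaceNormSq, multiplierNormSq, mul_left_comm]
  gcongr
  rw [← ENNReal.tsum_mul_left]
  refine ENNReal.tsum_le_tsum fun k => ?_
  rw [← lintegral_const_mul' _ _ ENNReal.ofReal_ne_top]
  refine lintegral_mono_ae ?_
  rw [fourierTransform_sub]
  filter_upwards [Lp.coeFn_sub (fourierTransform (translate h u) k) (fourierTransform u k),
    fourierTransform_translate_ae h u k] with ξ h1 h2
  have h3 : phase h k ξ * fourierTransform u k ξ - fourierTransform u k ξ =
    (phase h k ξ - 1) * fourierTransform u k ξ := by ring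
  rw [h1, Pi.sub_apply, h2, h3, enorm_mul, mul_pow, ← mul_assoc,
    ← ENNReal.ofReal_mul (by positivity)]
  gcongr
  rw [← ofReal_norm, ← ENNReal.ofReal_pow (norm_nonneg _)]
  exact ENNReal.ofReal_le_ofReal (norm_phase_sub_one_sq_le hσ0 hσ1 h hr k ξ)

theorem multiplierNormSq_translate (w : ℝ → ℝ) (h : Domain d m) (u : L2 d m) :
    multiplierNormSq w (translate h u) = multiplierNormSq w u := by
  unfold multiplierNormSq
  congr 1
  refine tsum_congr fun k => lintegral_congr_ae ?_
  filter_upwards [fourierTransform_translate_ae h u k] with ξ h2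
  rw [h2, enorm_mul, ← ofReal_norm (phase h k ξ), norm_phase, ENNReal.ofReal_one, one_mul]

/-! ### Averages over balls -/

theorem enorm_setIntegral_sq_le {α : Type*} [MeasurableSpace α] {μ : Measure α} (s : Set α)
    {f : α → ℂ} (hf : AEStronglyMeasurable f (μ.restrict s)) :
    ‖∫ x in s, f x ∂μ‖ₑ ^ 2 ≤ μ s * ∫⁻ x in s, ‖f x‖ₑ ^ 2 ∂μ := by
  have h2 := ENNReal.lintegral_mul_le_Lp_mul_Lq (μ.restrict s)
    Real.HolderConjugate.two_two (aemeasurable_const (b := (1 : ℝ≥0∞))) hf.enorm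
  simp only [Pi.mul_apply, one_mul, ENNReal.one_rpow, lintegral_one, Measure.restrict_apply_univ]
    at h2
  have h3 := ENNReal.rpow_le_rpow ((enorm_integral_le_lintegral_enorm f).trans h2)
    (by norm_num : (0 : ℝ) ≤ 2)
  rw [ENNReal.mul_rpow_of_nonneg _ _ (by norm_num), ← ENNReal.rpow_mul, ← ENNReal.rpow_mul] at h3
  norm_num at h3
  exact h3

/-- For radii at most half of the period, the volume of a ball of the domain (for the sup-product
metric) is `κ r^{d+m}`. -/
theorem exists_volume_closedBall_domain (d m : ℕ) : ∃ κ : ℝ, 0 < κ ∧ ∀ r : ℝ, 0 < r → r ≤ Real.pi →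
    ∀ p : Domain d m, volume (Metric.closedBall p r) = ENNReal.ofReal (κ * r ^ (d + m)) := by
  set v := volume (Metric.ball (0 : EuclideanSpace ℝ (Fin d)) 1) with hv
  have hv0 : v ≠ 0 := (Metric.measure_ball_pos _ _ one_pos).ne'
  have hvt : v ≠ ∞ := measure_ball_lt_top.ne
  refine ⟨v.toReal * 2 ^ m, mul_pos (ENNReal.toReal_pos hv0 hvt) (by positivity),
    fun r hr hrpi p => ?_⟩
  obtain ⟨x, y⟩ := p
  have hball : Metric.closedBall ((x, y) : Domain d m) r =
      Metric.closedBall x r ×ˢ Metric.closedBall y r := (closedBall_prod_same x y r).symm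
  have hprod : volume (Metric.closedBall x r ×ˢ Metric.closedBall y r) =
      volume (Metric.closedBall x r) * volume (Metric.closedBall y r) := Measure.prod_prod _ _
  rw [hball, hprod, Measure.addHaar_closedBall _ _ hr.le, closedBall_pi _ hr.le, volume_pi,
    Measure.pi_pi]
  simp only [AddCircle.volume_closedBall, finrank_euclideanSpace, Fintype.card_fin,
    Finset.prod_const, Finset.card_univ]
  rw [min_eq_right (by linarith), ← hv, ← ENNReal.ofReal_toReal hvt,
    ← ENNReal.ofReal_pow (by positivity), ← ENNReal.ofReal_mul (by positivity),
    ← ENNReal.ofReal_mul (by positivity), ENNReal.toReal_ofReal ENNReal.toReal_nonneg]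
  congr 1
  ring

theorem volume_closedBall_domain_pos (p : Domain d m) {r : ℝ} (hr : 0 < r) :
    0 < volume (Metric.closedBall p r) := Metric.measure_closedBall_pos _ _ hr

theorem volume_closedBall_domain_lt_top (p : Domain d m) (r : ℝ) :
    volume (Metric.closedBall p r) < ∞ := (isCompact_closedBall p r).measure_lt_top

/-- The mean of `u` over the closed ball of radius `r` around `p`. -/
noncomputable def ballAverage (r : ℝ) (u : Domain d m → ℂ) (p : Domain d m) : ℂ :=
  ⨍ q in Metric.closedBall p r, u q

theorem setIntegral_closedBall_eq (u : Domain d m → ℂ) (p : Domain d m) (r : ℝ) :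
    ∫ q in Metric.closedBall p r, u q = ∫ h in Metric.closedBall (0 : Domain d m) r, u (p + h) := by
  have hmp := measurePreserving_add_left (volume : Measure (Domain d m)) p
  have h := hmp.setIntegral_preimage_emb (measurableEmbedding_addLeft p) u (Metric.closedBall p r)
  rw [← h]
  congr 2
  ext q
  simp [dist_eq_norm]

theorem volume_closedBall_domain_eq (p : Domain d m) (r : ℝ) :
    volume (Metric.closedBall p r) = volume (Metric.closedBall (0 : Domain d m) r) := by
  have hmp := measurePreserving_add_left (volume : Measure (Domain d m)) p
  have h := hmp.measure_preimage_emb (measurableEmbedding_addLeft p) (Metric.closedBall p r)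
  rw [← h]
  congr 1
  ext q
  simp [dist_eq_norm]

theorem ballAverage_eq (r : ℝ) (u : Domain d m → ℂ) (p : Domain d m) :
    ballAverage r u p = ⨍ h in Metric.closedBall (0 : Domain d m) r, u (p + h) := by
  rw [ballAverage, setAverage_eq, setAverage_eq, setIntegral_closedBall_eq, Measure.real,
    volume_closedBall_domain_eq, Measure.real]

theorem enorm_setAverage_sq_le {α : Type*} [MeasurableSpace α] {μ : Measure α} {s : Set α}
    (h0 : μ s ≠ 0) (ht : μ s ≠ ∞)
    {f : α → ℂ} (hf : AEStronglyMeasurable f (μ.restrict s)) :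
    ‖⨍ x in s, f x ∂μ‖ₑ ^ 2 ≤ (μ s)⁻¹ * ∫⁻ x in s, ‖f x‖ₑ ^ 2 ∂μ := by
  have hpos : 0 < μ.real s := ENNReal.toReal_pos h0 ht
  have he : ‖(μ.real s)⁻¹‖ₑ = (μ s)⁻¹ := by
    rw [Real.enorm_of_nonneg (inv_pos.2 hpos).le, ENNReal.ofReal_inv_of_pos hpos, Measure.real,
      ENNReal.ofReal_toReal ht]
  rw [setAverage_eq, enorm_smul, he, mul_pow]
  calc (μ s)⁻¹ ^ 2 * ‖∫ x in s, f x ∂μ‖ₑ ^ 2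
      ≤ (μ s)⁻¹ ^ 2 * (μ s * ∫⁻ x in s, ‖f x‖ₑ ^ 2 ∂μ) := by
        gcongr
        exact enorm_setIntegral_sq_le s hf
    _ = (μ s)⁻¹ * ∫⁻ x in s, ‖f x‖ₑ ^ 2 ∂μ := by
        rw [sq, mul_assoc, ← mul_assoc (μ s)⁻¹ (μ s), ENNReal.inv_mul_cancel h0 ht, one_mul]

theorem enorm_ballAverage_sq_le {r : ℝ} (hr : 0 < r) (u : L2 d m) (p : Domain d m) :
    ‖ballAverage r u p‖ₑ ^ 2 ≤ (volume (Metric.closedBall p r))⁻¹ * ‖u‖ₑ ^ 2 := by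
  refine (enorm_setAverage_sq_le (volume_closedBall_domain_pos p hr).ne'
    (volume_closedBall_domain_lt_top p r).ne (Lp.aestronglyMeasurable u).restrict).trans ?_
  gcongr
  rw [← lintegral_enorm_sq_eq]
  exact setLIntegral_le_lintegral _ _

theorem integrableOn_add_left (u : L2 d m) (p : Domain d m) (r : ℝ) :
    IntegrableOn (fun h => u (p + h)) (Metric.closedBall (0 : Domain d m) r) := by
  have hmp := measurePreserving_add_left (volume : Measure (Domain d m)) p
  have h1 : MemLp (fun h => u (p + h)) 2 (volume : Measure (Domain d m)) :=
    (Lp.memLp u).comp_measurePreserving hmp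
  have : IsFiniteMeasure ((volume : Measure (Domain d m)).restrict (Metric.closedBall 0 r)) :=
    ⟨by rw [Measure.restrict_apply_univ]; exact volume_closedBall_domain_lt_top 0 r⟩
  exact (h1.restrict _).integrable (by norm_num)

/-- Averaging over balls of radius `r` changes `u` by `O(r^σ)` in `L²`. -/
theorem lintegral_enorm_sub_ballAverage_sq_le {σ : ℝ} (hσ0 : 0 < σ) (hσ1 : σ < 1) {r : ℝ}
    (hr : 0 < r) (u : L2 d m) :
    ∫⁻ p, ‖u p - ballAverage r u p‖ₑ ^ 2 ≤
      ENNReal.ofReal (4 * ((m + 1) * r ^ 2) ^ σ) * fracLaplaceNormSq σ u := by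
  set B := Metric.closedBall (0 : Domain d m) r with hB
  have hB0 : volume B ≠ 0 := (volume_closedBall_domain_pos 0 hr).ne'
  have hBt : volume B ≠ ∞ := (volume_closedBall_domain_lt_top 0 r).ne
  have hum : Measurable (u : Domain d m → ℂ) := (Lp.stronglyMeasurable u).measurable
  have hfin : IsFiniteMeasure ((volume : Measure (Domain d m)).restrict B) :=
    ⟨by rw [Measure.restrict_apply_univ]; exact hBt.lt_top⟩
  have h1 : ∀ p : Domain d m, ‖u p - ballAverage r u p‖ₑ ^ 2 ≤
      (volume B)⁻¹ * ∫⁻ h in B, ‖u p - u (p + h)‖ₑ ^ 2 := by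
    intro p
    have : u p - ballAverage r u p = ⨍ h in B, (u p - u (p + h)) := by
      have hc := setAverage_const (μ := volume) hB0 hBt (u p)
      rw [setAverage_eq] at hc
      rw [ballAverage_eq, ← hB, setAverage_eq, setAverage_eq, integral_sub (integrable_const _)
        (integrableOn_add_left u p r), smul_sub, hc]
    rw [this]
    exact enorm_setAverage_sq_le hB0 hBt (by
      have : Measurable fun h => u p - u (p + h) := by fun_prop
      exact this.aestronglyMeasurable)
  refine (lintegral_mono h1).trans ?_
  have hm2 : Measurable (Function.uncurry fun p h : Domain d m => ‖u p - u (p + h)‖ₑ ^ 2) := by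
    unfold Function.uncurry
    fun_prop
  rw [lintegral_const_mul' _ _ (ENNReal.inv_ne_top.2 hB0),
    lintegral_lintegral_swap hm2.aemeasurable]
  have h2 : ∀ h ∈ B, ∫⁻ p, ‖u p - u (p + h)‖ₑ ^ 2 ≤
      ENNReal.ofReal (4 * ((m + 1) * r ^ 2) ^ σ) * fracLaplaceNormSq σ u := by
    intro h hh
    have hh' : ‖h‖ ≤ r := by simpa [hB] using hh
    refine le_trans (le_of_eq ?_) (enorm_translate_sub_sq_le hσ0 hσ1 h hh' u)
    rw [← lintegral_enorm_sq_eq]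
    refine lintegral_congr_ae ?_
    filter_upwards [Lp.coeFn_sub (translate h u) u, translate_ae h u] with p h1 h2
    rw [h1, Pi.sub_apply, h2, ← enorm_neg, neg_sub]
  calc (volume B)⁻¹ * ∫⁻ h in B, ∫⁻ p, ‖u p - u (p + h)‖ₑ ^ 2
      ≤ (volume B)⁻¹ * ∫⁻ _ in B, ENNReal.ofReal (4 * ((m + 1) * r ^ 2) ^ σ) *
        fracLaplaceNormSq σ u := by
        gcongr 1
        exact setLIntegral_mono' Metric.isClosed_closedBall.measurableSet h2
    _ = _ := by
        rw [setLIntegral_const, mul_comm, mul_assoc, ENNReal.mul_inv_cancel hB0 hBt, mul_one]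

/-- If the averages of `u` at scale `r` are at most `l / 2`, then the part of `u` above level `l`
is controlled by the oscillation of `u` at scale `r`. -/
theorem setLIntegral_superlevel_sq_le {σ : ℝ} (hσ0 : 0 < σ) (hσ1 : σ < 1) {r l : ℝ}
    (hr : 0 < r) (u : L2 d m) (hl : ∀ p, ‖ballAverage r u p‖ ≤ l / 2) :
    ∫⁻ p in {p | l < ‖u p‖}, ‖u p‖ₑ ^ 2 ≤
      ENNReal.ofReal (16 * ((m + 1) * r ^ 2) ^ σ) * fracLaplaceNormSq σ u := by
  have hum : Measurable (u : Domain d m → ℂ) := (Lp.stronglyMeasurable u).measurable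
  calc ∫⁻ p in {p | l < ‖u p‖}, ‖u p‖ₑ ^ 2
      ≤ ∫⁻ p in {p | l < ‖u p‖}, ENNReal.ofReal 4 * ‖u p - ballAverage r u p‖ₑ ^ 2 := by
        refine setLIntegral_mono' (measurableSet_lt measurable_const hum.norm) fun p hp => ?_
        rw [← ofReal_norm, ← ofReal_norm, ← ENNReal.ofReal_pow (norm_nonneg _),
          ← ENNReal.ofReal_pow (norm_nonneg _), ← ENNReal.ofReal_mul (by norm_num)]
        refine ENNReal.ofReal_le_ofReal ?_
        have h1 : ‖u p‖ ≤ ‖u p - ballAverage r u p‖ + ‖ballAverage r u p‖ := by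
          simpa using norm_add_le (u p - ballAverage r u p) (ballAverage r u p)
        have h2 := hl p
        have h3 : l < ‖u p‖ := hp
        nlinarith [norm_nonneg (u p)]
    _ ≤ ENNReal.ofReal 4 * ∫⁻ p, ‖u p - ballAverage r u p‖ₑ ^ 2 := by
        rw [lintegral_const_mul' _ _ ENNReal.ofReal_ne_top]
        gcongr
        exact Measure.restrict_le_self
    _ ≤ ENNReal.ofReal 4 * (ENNReal.ofReal (4 * ((m + 1) * r ^ 2) ^ σ) *
          fracLaplaceNormSq σ u) := by
        gcongr
        exact lintegral_enorm_sub_ballAverage_sq_le hσ0 hσ1 hr u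
    _ = _ := by
        rw [← mul_assoc, ← ENNReal.ofReal_mul (by norm_num)]
        congr 2
        ring

/-! ### Coercivity and nonvanishing -/

/-- A weak-type estimate: the part of `u` above a high level `l` has square mass at most a constant
times `l ^ (-4σ/(d+m)) ‖(-Δ)^{σ/2} u‖₂²`. By Cauchy–Schwarz the averages of `u` at scale `r` are at most
a constant times `r ^ (-(d+m)/2)`, so that `setLIntegral_superlevel_sq_le` applies with `r` of order
`l ^ (-2/(d+m))`. -/
theorem exists_setLIntegral_superlevel_sq_le (hd : 1 ≤ d) {σ : ℝ} (hσ0 : 0 < σ) (hσ1 : σ < 1)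
    (M : ℝ) : ∃ D L : ℝ, 0 < D ∧ 0 < L ∧ ∀ l, L ≤ l → ∀ u : L2 d m, ‖u‖ ^ 2 ≤ M →
      ∫⁻ p in {p | l < ‖u p‖}, ‖u p‖ₑ ^ 2 ≤
        ENNReal.ofReal (D * l ^ (-(4 * σ / ((d : ℝ) + m)))) * fracLaplaceNormSq σ u := by
  obtain ⟨κ, hκ, hvol⟩ := exists_volume_closedBall_domain d m
  set M' : ℝ := max M 1 with hM'
  have hM'0 : 0 < M' := lt_of_lt_of_le one_pos (le_max_right _ _)
  set N : ℝ := (d : ℝ) + m with hN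
  have hd' : (1 : ℝ) ≤ d := by exact_mod_cast hd
  have hN0 : 0 < N := by positivity
  set A : ℝ := 4 * M' / κ with hA
  have hA0 : 0 < A := by positivity
  -- The radius `r` is chosen so that `κ r ^ N = 4 M' / l ^ 2`.
  set ρ : ℝ → ℝ := fun l => (A * l ^ (-2 : ℝ)) ^ (1 / N) with hρ
  have hρt : Filter.Tendsto ρ Filter.atTop (nhds 0) := by
    have h1 : Filter.Tendsto (fun l : ℝ => A * l ^ (-2 : ℝ)) Filter.atTop (nhds (A * 0)) :=
      (tendsto_rpow_neg_atTop (by norm_num : (0 : ℝ) < 2)).const_mul A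
    have h2 := h1.rpow_const (p := 1 / N) (Or.inr (by positivity))
    rwa [mul_zero, Real.zero_rpow (by positivity)] at h2
  obtain ⟨L, hL⟩ := Filter.eventually_atTop.1 (hρt.eventually (ge_mem_nhds Real.pi_pos))
  refine ⟨16 * (((m : ℝ) + 1) ^ σ * A ^ (2 * σ / N)), max L 1, by positivity,
    lt_of_lt_of_le one_pos (le_max_right _ _), fun l hl u hu => ?_⟩
  have hl0 : 0 < l := lt_of_lt_of_le (lt_of_lt_of_le one_pos (le_max_right _ _)) hl
  have hr0 : 0 < ρ l := by positivity
  have hrN : ρ l ^ (d + m) = A * l ^ (-2 : ℝ) := by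
    rw [← Real.rpow_natCast, hρ, ← Real.rpow_mul (by positivity)]
    push_cast
    rw [← hN, one_div, inv_mul_cancel₀ hN0.ne', Real.rpow_one]
  have havg : ∀ p, ‖ballAverage (ρ l) u p‖ ≤ l / 2 := by
    intro p
    have h1 := enorm_ballAverage_sq_le hr0 u p
    rw [hvol _ hr0 (hL l ((le_max_left _ _).trans hl)), ← ofReal_norm, ← ofReal_norm,
      ← ENNReal.ofReal_pow (norm_nonneg _), ← ENNReal.ofReal_pow (norm_nonneg _),
      ← ENNReal.ofReal_inv_of_pos (by positivity), ← ENNReal.ofReal_mul (by positivity),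
      ENNReal.ofReal_le_ofReal_iff (by positivity), hrN] at h1
    have h2 : (κ * (A * l ^ (-2 : ℝ)))⁻¹ * ‖u‖ ^ 2 ≤ (l / 2) ^ 2 := by
      have h3 : ‖u‖ ^ 2 ≤ M' := hu.trans (le_max_left _ _)
      have h4 : (κ * (A * l ^ (-2 : ℝ)))⁻¹ = l ^ 2 / (4 * M') := by
        rw [hA, Real.rpow_neg hl0.le, Real.rpow_ofNat]
        field_simp
      rw [h4]
      calc l ^ 2 / (4 * M') * ‖u‖ ^ 2 ≤ l ^ 2 / (4 * M') * M' := by gcongr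
        _ = (l / 2) ^ 2 := by field_simp; ring
    exact (sq_le_sq₀ (norm_nonneg _) (by positivity)).1 (h1.trans h2)
  refine (setLIntegral_superlevel_sq_le hσ0 hσ1 hr0 u havg).trans_eq ?_
  congr 2
  rw [Real.mul_rpow (by positivity) (by positivity), mul_assoc, mul_assoc]
  congr 2
  rw [← Real.rpow_natCast, ← Real.rpow_mul hr0.le, hρ, ← Real.rpow_mul (by positivity),
    Real.mul_rpow (by positivity) (by positivity), ← Real.rpow_mul hl0.le]
  congr 2
  · push_cast; field_simp
  · push_cast; field_simp; norm_num

/-- A dyadic form of the layer-cake decomposition. -/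
theorem enorm_rpow_le_tsum_dyadic {α : ℝ} (hα0 : 0 < α) {L : ℝ} (hL : 0 < L) {z : ℂ}
    (hz : L < ‖z‖) :
    ‖z‖ₑ ^ α ≤ ∑' j : ℕ, ENNReal.ofReal ((2 ^ (j + 1) * L) ^ α) *
      {z : ℂ | 2 ^ j * L < ‖z‖}.indicator 1 z := by
  obtain ⟨n, hn1, hn2⟩ : ∃ n : ℕ, 2 ^ n * L < ‖z‖ ∧ ‖z‖ ≤ 2 ^ (n + 1) * L := by
    have hex : ∃ n : ℕ, ‖z‖ ≤ 2 ^ (n + 1) * L := by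
      obtain ⟨n, hn⟩ := pow_unbounded_of_one_lt (‖z‖ / L) (one_lt_two (α := ℝ))
      refine ⟨n, ?_⟩
      rw [div_lt_iff₀ hL] at hn
      refine hn.le.trans ?_
      gcongr
      · norm_num
      · omega
    classical
    refine ⟨Nat.find hex, ?_, Nat.find_spec hex⟩
    rcases Nat.eq_zero_or_pos (Nat.find hex) with h | h
    · rw [h]; simpa using hz
    · have := Nat.find_min hex (Nat.sub_lt h one_pos)
      rw [Nat.sub_add_cancel (show 1 ≤ Nat.find hex from h)] at this
      exact not_le.1 this
  refine le_trans ?_ (ENNReal.le_tsum n)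
  rw [Set.indicator_of_mem (by exact hn1), Pi.one_apply, mul_one,
    ← ENNReal.ofReal_rpow_of_nonneg (by positivity) hα0.le, ← ofReal_norm]
  gcongr

/-- In the mass-subcritical range `α < 4σ/(d+m)`, the contribution of high levels to
`‖u‖_{α+2}^{α+2}` is an arbitrarily small multiple of `‖(-Δ)^{σ/2} u‖₂²`. -/
theorem exists_setLIntegral_superlevel_rpow_le (hd : 1 ≤ d) {σ : ℝ} (hσ0 : 0 < σ) (hσ1 : σ < 1)
    {α : ℝ} (hα0 : 0 < α) (hα : α < 4 * σ / ((d : ℝ) + m)) (M : ℝ) {ε : ℝ} (hε : 0 < ε) :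
    ∃ L : ℝ, 0 < L ∧ ∀ u : L2 d m, ‖u‖ ^ 2 ≤ M →
      ∫⁻ p in {p | L < ‖u p‖}, ‖u p‖ₑ ^ (α + 2) ≤ ENNReal.ofReal ε * fracLaplaceNormSq σ u := by
  obtain ⟨D, L₀, hD, hL₀, hmain⟩ :=
    exists_setLIntegral_superlevel_sq_le (d := d) (m := m) hd hσ0 hσ1 M
  set γ : ℝ := 4 * σ / ((d : ℝ) + m) with hγ
  set q : ℝ := 2 ^ (α - γ) with hq
  have hq0 : 0 < q := by positivity
  have hq1 : q < 1 := Real.rpow_lt_one_of_one_lt_of_neg one_lt_two (by linarith)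
  have hlim : Filter.Tendsto (fun L : ℝ => (2 ^ α * D * (1 - q)⁻¹) * L ^ (-(γ - α))) Filter.atTop
      (nhds 0) := by
    simpa using (tendsto_rpow_neg_atTop (by linarith : 0 < γ - α)).const_mul
      (2 ^ α * D * (1 - q)⁻¹)
  obtain ⟨L, hLε, hLL⟩ := ((hlim.eventually (ge_mem_nhds hε)).and
    (Filter.eventually_ge_atTop L₀)).exists
  have hL0 : 0 < L := hL₀.trans_le hLL
  refine ⟨L, hL0, fun u hu => ?_⟩
  have hum : Measurable (u : Domain d m → ℂ) := (Lp.stronglyMeasurable u).measurable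
  have hms : ∀ l : ℝ, MeasurableSet {p | l < ‖u p‖} := fun l =>
    measurableSet_lt measurable_const hum.norm
  calc ∫⁻ p in {p | L < ‖u p‖}, ‖u p‖ₑ ^ (α + 2)
      ≤ ∫⁻ p, ∑' j : ℕ, ENNReal.ofReal ((2 ^ (j + 1) * L) ^ α) *
          {p | 2 ^ j * L < ‖u p‖}.indicator (fun p => ‖u p‖ₑ ^ 2) p := by
        refine (setLIntegral_mono' (hms L) fun p hp => ?_).trans (setLIntegral_le_lintegral _ _)
        rw [ENNReal.rpow_add_of_nonneg _ _ hα0.le (by norm_num), ENNReal.rpow_ofNat]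
        refine (mul_le_mul_left (enorm_rpow_le_tsum_dyadic hα0 hL0 hp) _).trans_eq ?_
        rw [← ENNReal.tsum_mul_right]
        refine tsum_congr fun j => ?_
        rw [mul_assoc]
        congr 1
        by_cases h : 2 ^ j * L < ‖u p‖ <;> simp [h]
    _ = ∑' j : ℕ, ENNReal.ofReal ((2 ^ (j + 1) * L) ^ α) *
          ∫⁻ p in {p | 2 ^ j * L < ‖u p‖}, ‖u p‖ₑ ^ 2 := by
        rw [lintegral_tsum fun j => ((((hum.enorm.pow_const 2).indicator (hms _)).const_mul
          _).aemeasurable)]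
        refine tsum_congr fun j => ?_
        rw [lintegral_const_mul' _ _ ENNReal.ofReal_ne_top, lintegral_indicator (hms _)]
    _ ≤ ∑' j : ℕ, ENNReal.ofReal (2 ^ α * D * L ^ (-(γ - α)) * q ^ j) *
          fracLaplaceNormSq σ u := by
        refine ENNReal.tsum_le_tsum fun j => ?_
        have hj : L₀ ≤ 2 ^ j * L := hLL.trans (le_mul_of_one_le_left hL0.le
          (one_le_pow₀ one_le_two))
        refine (mul_le_mul_right (hmain _ hj u hu) _).trans_eq ?_
        rw [← mul_assoc, ← ENNReal.ofReal_mul (by positivity)]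
        congr 2
        have hx : (0 : ℝ) < 2 ^ j := by positivity
        rw [hq, Real.rpow_pow_comm (by norm_num), pow_succ', mul_assoc,
          Real.mul_rpow (by norm_num) (by positivity), Real.mul_rpow hx.le hL0.le,
          Real.mul_rpow hx.le hL0.le, neg_sub, sub_eq_add_neg, Real.rpow_add hL0, Real.rpow_add hx]
        ring
    _ = ENNReal.ofReal ((2 ^ α * D * (1 - q)⁻¹) * L ^ (-(γ - α))) * fracLaplaceNormSq σ u := by
        rw [ENNReal.tsum_mul_right, ← ENNReal.ofReal_tsum_of_nonneg (fun j => by positivity)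
          ((summable_geometric_of_lt_one hq0.le hq1).mul_left _), tsum_mul_left,
          tsum_geometric_of_lt_one hq0.le hq1]
        congr 2
        ring
    _ ≤ _ := by gcongr

/-- The splitting of `‖u‖_{α+2}^{α+2}` into the low levels `|u| ≤ l`, the middle levels and the high levels
`|u| > L`. -/
theorem lintegral_rpow_le_of_sublevel {α : ℝ} (hα0 : 0 < α) (u : L2 d m) {l L : ℝ} :
    ∫⁻ p, ‖u p‖ₑ ^ (α + 2) ≤ ENNReal.ofReal (l ^ α) * ‖u‖ₑ ^ 2 +
      (ENNReal.ofReal (L ^ α) * (∫⁻ p in {p | l < ‖u p‖}, ‖u p‖ₑ ^ 2) +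
        ∫⁻ p in {p | L < ‖u p‖}, ‖u p‖ₑ ^ (α + 2)) := by
  have hum : Measurable (u : Domain d m → ℂ) := (Lp.stronglyMeasurable u).measurable
  have hms : ∀ l : ℝ, MeasurableSet {p | l < ‖u p‖} := fun l =>
    measurableSet_lt measurable_const hum.norm
  rw [← lintegral_enorm_sq_eq, ← lintegral_const_mul' _ _ ENNReal.ofReal_ne_top,
    ← lintegral_const_mul' _ _ ENNReal.ofReal_ne_top, ← lintegral_indicator (hms l),
    ← lintegral_indicator (hms L),
    ← lintegral_add_left (((hum.enorm.pow_const 2).const_mul _).indicator (hms l)),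
    ← lintegral_add_left ((hum.enorm.pow_const 2).const_mul _)]
  refine lintegral_mono fun p => ?_
  have hsplit : ‖u p‖ₑ ^ (α + 2) = ‖u p‖ₑ ^ α * ‖u p‖ₑ ^ 2 := by
    rw [ENNReal.rpow_add_of_nonneg _ _ hα0.le (by norm_num), ENNReal.rpow_ofNat]
  have hle : ∀ t : ℝ, ‖u p‖ ≤ t → ‖u p‖ₑ ^ (α + 2) ≤ ENNReal.ofReal (t ^ α) * ‖u p‖ₑ ^ 2 := by
    intro t ht
    rw [hsplit, ← ENNReal.ofReal_rpow_of_nonneg ((norm_nonneg _).trans ht) hα0.le, ← ofReal_norm]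
    gcongr
  rcases le_or_gt ‖u p‖ l with h | h
  · exact (hle l h).trans le_self_add
  · rcases le_or_gt ‖u p‖ L with h' | h'
    · refine (hle L h').trans (le_add_left ?_)
      rw [Set.indicator_of_mem (by exact h)]
      exact le_self_add
    · refine le_add_left (le_add_left ?_)
      rw [Set.indicator_of_mem (by exact h')]

/-- Coercivity: `‖u‖_{α+2}^{α+2} ≤ ε ‖(-Δ)^{σ/2} u‖₂² + C` on bounded sets of `L²`. -/
theorem exists_lintegral_rpow_le (hd : 1 ≤ d) {σ : ℝ} (hσ0 : 0 < σ) (hσ1 : σ < 1)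
    {α : ℝ} (hα0 : 0 < α) (hα : α < 4 * σ / ((d : ℝ) + m)) (M : ℝ) {ε : ℝ} (hε : 0 < ε) :
    ∃ C : ℝ, 0 < C ∧ ∀ u : L2 d m, ‖u‖ ^ 2 ≤ M →
      ∫⁻ p, ‖u p‖ₑ ^ (α + 2) ≤ ENNReal.ofReal C + ENNReal.ofReal ε * fracLaplaceNormSq σ u := by
  obtain ⟨L, hL, h⟩ := exists_setLIntegral_superlevel_rpow_le (d := d) (m := m)
    hd hσ0 hσ1 hα0 hα M hε
  refine ⟨L ^ α * max M 1, by positivity, fun u hu => ?_⟩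
  have hum : Measurable (u : Domain d m → ℂ) := (Lp.stronglyMeasurable u).measurable
  have hms : MeasurableSet {p | L < ‖u p‖} := measurableSet_lt measurable_const hum.norm
  rw [← lintegral_add_compl _ hms, add_comm]
  refine add_le_add ?_ (h u hu)
  calc ∫⁻ p in {p | L < ‖u p‖}ᶜ, ‖u p‖ₑ ^ (α + 2)
      ≤ ∫⁻ p in {p | L < ‖u p‖}ᶜ, ENNReal.ofReal (L ^ α) * ‖u p‖ₑ ^ 2 := by
        refine setLIntegral_mono' hms.compl fun p hp => ?_
        rw [ENNReal.rpow_add_of_nonneg _ _ hα0.le (by norm_num), ENNReal.rpow_ofNat,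
          ← ENNReal.ofReal_rpow_of_nonneg hL.le hα0.le, ← ofReal_norm]
        have : ‖u p‖ ≤ L := not_lt.1 hp
        gcongr
    _ ≤ ENNReal.ofReal (L ^ α) * ‖u‖ₑ ^ 2 := by
        rw [lintegral_const_mul' _ _ ENNReal.ofReal_ne_top, ← lintegral_enorm_sq_eq]
        gcongr
        exact Measure.restrict_le_self
    _ ≤ _ := by
        rw [ENNReal.ofReal_mul (by positivity), ← ofReal_norm, ← ENNReal.ofReal_pow (norm_nonneg _)]
        gcongr
        exact hu.trans (le_max_left _ _)

/-- Nonvanishing: if `u` is bounded in `H^σ` and `‖u‖_{α+2}` is bounded below, then the averages of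
`u` at some fixed scale are somewhere bounded below. -/
theorem exists_le_norm_ballAverage (hd : 1 ≤ d) {σ : ℝ} (hσ0 : 0 < σ) (hσ1 : σ < 1)
    {α : ℝ} (hα0 : 0 < α) (hα : α < 4 * σ / ((d : ℝ) + m)) (M K : ℝ) {δ : ℝ} (hδ : 0 < δ) :
    ∃ r η : ℝ, 0 < r ∧ 0 < η ∧ ∀ u : L2 d m, ‖u‖ ^ 2 ≤ M →
      fracLaplaceNormSq σ u ≤ ENNReal.ofReal K →
      ENNReal.ofReal δ ≤ ∫⁻ p, ‖u p‖ₑ ^ (α + 2) → ∃ p, η < ‖ballAverage r u p‖ := by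
  set K' : ℝ := max K 1 with hK'
  have hK'0 : 0 < K' := lt_of_lt_of_le one_pos (le_max_right _ _)
  set M' : ℝ := max M 1 with hM'
  have hM'0 : 0 < M' := lt_of_lt_of_le one_pos (le_max_right _ _)
  obtain ⟨L, hL, htail⟩ := exists_setLIntegral_superlevel_rpow_le (d := d) (m := m)
    hd hσ0 hσ1 hα0 hα M (ε := δ / (4 * K')) (by positivity)
  -- `η` makes the low levels, and then `r` the middle levels, contribute at most `δ / 4`.
  obtain ⟨η, hη, hη0⟩ : ∃ η : ℝ, (2 * η) ^ α * M' ≤ δ / 4 ∧ 0 < η := by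
    have h1 : Filter.Tendsto (fun η : ℝ => (2 * η) ^ α * M') (nhdsWithin 0 (Set.Ioi 0))
        (nhds 0) := by
      have : ContinuousAt (fun η : ℝ => (2 * η) ^ α * M') 0 :=
        ((continuousAt_const.mul continuousAt_id).rpow_const (Or.inr hα0.le)).mul_const _
      have h2 := this.tendsto
      simp only [mul_zero, Real.zero_rpow hα0.ne', zero_mul] at h2
      exact h2.mono_left nhdsWithin_le_nhds
    exact ((h1.eventually (ge_mem_nhds (by positivity))).and self_mem_nhdsWithin).exists
  obtain ⟨r, hr, hr0⟩ : ∃ r : ℝ, L ^ α * (16 * ((m + 1) * r ^ 2) ^ σ * K') ≤ δ / 4 ∧ 0 < r := by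
    have h1 : Filter.Tendsto (fun r : ℝ => L ^ α * (16 * ((m + 1) * r ^ 2) ^ σ * K'))
        (nhdsWithin 0 (Set.Ioi 0)) (nhds 0) := by
      have : ContinuousAt (fun r : ℝ => L ^ α * (16 * ((m + 1) * r ^ 2) ^ σ * K')) 0 := by
        refine continuousAt_const.mul ((continuousAt_const.mul ?_).mul_const _)
        exact (continuousAt_const.mul (continuousAt_id.pow 2)).rpow_const (Or.inr hσ0.le)
      have h2 := this.tendsto
      simp only [ne_eq, OfNat.ofNat_ne_zero, not_false_eq_true, zero_pow, mul_zero,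
        Real.zero_rpow hσ0.ne', zero_mul] at h2
      exact h2.mono_left nhdsWithin_le_nhds
    exact ((h1.eventually (ge_mem_nhds (by positivity))).and self_mem_nhdsWithin).exists
  refine ⟨r, η, hr0, hη0, fun u hu hKu hlow => ?_⟩
  by_contra! hcon
  have h1 := setLIntegral_superlevel_sq_le hσ0 hσ1 hr0 u (l := 2 * η)
    (fun p => (hcon p).trans_eq (by ring))
  have hKu' : fracLaplaceNormSq σ u ≤ ENNReal.ofReal K' :=
    hKu.trans (ENNReal.ofReal_le_ofReal (le_max_left _ _))
  have h2 := lintegral_rpow_le_of_sublevel hα0 u (l := 2 * η) (L := L)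
  have h3 : ENNReal.ofReal ((2 * η) ^ α) * ‖u‖ₑ ^ 2 ≤ ENNReal.ofReal (δ / 4) := by
    rw [← ofReal_norm, ← ENNReal.ofReal_pow (norm_nonneg _), ← ENNReal.ofReal_mul (by positivity)]
    refine ENNReal.ofReal_le_ofReal (le_trans ?_ hη)
    gcongr
    exact hu.trans (le_max_left _ _)
  have h4 : ENNReal.ofReal (L ^ α) * ∫⁻ p in {p | 2 * η < ‖u p‖}, ‖u p‖ₑ ^ 2 ≤
      ENNReal.ofReal (δ / 4) := by
    calc _ ≤ ENNReal.ofReal (L ^ α) * (ENNReal.ofReal (16 * ((m + 1) * r ^ 2) ^ σ) *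
          ENNReal.ofReal K') := by gcongr; exact h1.trans (by gcongr)
      _ = ENNReal.ofReal (L ^ α * (16 * ((m + 1) * r ^ 2) ^ σ * K')) := by
          rw [← ENNReal.ofReal_mul (by positivity), ← ENNReal.ofReal_mul (by positivity)]
      _ ≤ _ := ENNReal.ofReal_le_ofReal hr
  have h5 : ∫⁻ p in {p | L < ‖u p‖}, ‖u p‖ₑ ^ (α + 2) ≤ ENNReal.ofReal (δ / 4) := by
    refine (htail u hu).trans ?_
    calc _ ≤ ENNReal.ofReal (δ / (4 * K')) * ENNReal.ofReal K' := by gcongr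
      _ = _ := by
        rw [← ENNReal.ofReal_mul (by positivity)]
        congr 1
        field_simp
  have h6 := hlow.trans (h2.trans (add_le_add h3 (add_le_add h4 h5)))
  rw [← ENNReal.ofReal_add (by positivity) (by positivity),
    ← ENNReal.ofReal_add (by positivity) (by positivity),
    ENNReal.ofReal_le_ofReal_iff (by positivity)] at h6
  linarith

/-! ### Weak convergence in Hilbert spaces -/

section WeakConvergence

open scoped InnerProductSpace Topology
open Filter

variable {H H' : Type*} [NormedAddCommGroup H] [InnerProductSpace ℂ H]
  [NormedAddCommGroup H'] [InnerProductSpace ℂ H']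

/-- Weak convergence of a sequence in a Hilbert space. -/
def WeakTendsto (x : ℕ → H) (v : H) : Prop :=
  ∀ y : H, Tendsto (fun n => ⟪y, x n⟫_ℂ) atTop (𝓝 ⟪y, v⟫_ℂ)

theorem WeakTendsto.comp {x : ℕ → H} {v : H} (h : WeakTendsto x v) {φ : ℕ → ℕ}
    (hφ : StrictMono φ) : WeakTendsto (x ∘ φ) v :=
  fun y => (h y).comp hφ.tendsto_atTop

theorem WeakTendsto.map [CompleteSpace H] [CompleteSpace H'] {x : ℕ → H} {v : H}
    (h : WeakTendsto x v) (T : H →L[ℂ] H') : WeakTendsto (fun n => T (x n)) (T v) := by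
  intro y
  simpa only [ContinuousLinearMap.adjoint_inner_left] using h (T.adjoint y)

theorem WeakTendsto.unique {x : ℕ → H} {v w : H} (h : WeakTendsto x v) (h' : WeakTendsto x w) :
    v = w :=
  ext_inner_left ℂ fun y => tendsto_nhds_unique (h y) (h' y)

theorem WeakTendsto.norm_sq_sub {x : ℕ → H} {v : H} (h : WeakTendsto x v) :
    Tendsto (fun n => ‖x n‖ ^ 2 - ‖x n - v‖ ^ 2) atTop (𝓝 (‖v‖ ^ 2)) := by
  have h1 : Tendsto (fun n => 2 * (⟪v, x n⟫_ℂ).re - ‖v‖ ^ 2) atTop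
      (𝓝 (2 * (⟪v, v⟫_ℂ).re - ‖v‖ ^ 2)) :=
    ((Complex.continuous_re.tendsto _).comp (h v)).const_mul 2 |>.sub_const _
  have h2 : 2 * (⟪v, v⟫_ℂ).re - ‖v‖ ^ 2 = ‖v‖ ^ 2 := by
    have := inner_self_eq_norm_sq (𝕜 := ℂ) v
    rw [RCLike.re_eq_complex_re] at this
    rw [this]; ring
  rw [h2] at h1
  refine h1.congr fun n => ?_
  have := norm_sub_sq (𝕜 := ℂ) (x n) v
  rw [RCLike.re_eq_complex_re, ← inner_conj_symm, Complex.conj_re] at this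
  rw [this]; ring

/-- Bounded sequences in a separable Hilbert space have weakly convergent subsequences, by the
sequential Banach–Alaoglu theorem and the Riesz representation. -/
theorem exists_weakTendsto_subseq [CompleteSpace H] [TopologicalSpace.SeparableSpace H]
    {x : ℕ → H} {C : ℝ} (hx : ∀ n, ‖x n‖ ≤ C) :
    ∃ (v : H) (φ : ℕ → ℕ), StrictMono φ ∧ WeakTendsto (x ∘ φ) v := by
  set f : ℕ → WeakDual ℂ H := fun n => StrongDual.toWeakDual (InnerProductSpace.toDual ℂ H (x n))
    with hf
  obtain ⟨g, -, φ, hφ, hg⟩ := WeakDual.isSeqCompact_closedBall ℂ H 0 C (x := f) (fun n => by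
    simp only [Set.mem_preimage, hf, Metric.mem_closedBall, dist_zero_right]
    exact ((InnerProductSpace.toDual ℂ H).norm_map (x n)).trans_le (hx n))
  refine ⟨(InnerProductSpace.toDual ℂ H).symm (WeakDual.toStrongDual g), φ, hφ, fun y => ?_⟩
  have h1 : Tendsto (fun n => (f (φ n)) y) atTop (𝓝 (g y)) :=
    ((WeakDual.eval_continuous y).tendsto g).comp hg
  have h2 := (Complex.continuous_conj.tendsto _).comp h1
  rw [← inner_conj_symm, InnerProductSpace.toDual_symm_apply]
  refine h2.congr fun n => ?_
  exact inner_conj_symm _ _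

end WeakConvergence

/-! ### Weak compactness in `H^σ` -/

/-- Frequency space `ℤ^m × ℝ^d`, dual to `𝕋^m × ℝ^d`. -/
abbrev Freq (d m : ℕ) : Type := (Fin m → ℤ) × EuclideanSpace ℝ (Fin d)

/-- The product of counting measure on `ℤ^m` and Lebesgue measure on `ℝ^d`. -/
noncomputable abbrev freqMeasure (d m : ℕ) : Measure (Freq d m) :=
  (Measure.count : Measure (Fin m → ℤ)).prod volume

theorem lintegral_freqMeasure {f : Freq d m → ℝ≥0∞} (hf : Measurable f) :
    ∫⁻ p, f p ∂(freqMeasure d m) = ∑' k : Fin m → ℤ, ∫⁻ ξ, f (k, ξ) := by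
  rw [lintegral_prod _ hf.aemeasurable, lintegral_count]

theorem ae_eq_freqMeasure {f g : Freq d m → ℂ} (hf : Measurable f) (hg : Measurable g)
    (h : ∀ k : Fin m → ℤ, ∀ᵐ ξ : EuclideanSpace ℝ (Fin d), f (k, ξ) = g (k, ξ)) :
    f =ᵐ[freqMeasure d m] g :=
  (Measure.ae_prod_iff_ae_ae (measurableSet_eq_fun hf hg)).2 (.of_forall h)

theorem measurable_fourierTransform (u : L2 d m) :
    Measurable fun p : Freq d m => fourierTransform u p.1 p.2 :=
  measurable_from_prod_countable_right fun k =>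
    (Lp.stronglyMeasurable (fourierTransform u k)).measurable

theorem measurable_laplaceSymbol :
    Measurable fun p : Freq d m => laplaceSymbol p.2 p.1 := by
  unfold laplaceSymbol
  refine measurable_from_prod_countable_right fun k => ?_
  fun_prop

theorem one_le_two_pi_pow (m : ℕ) : 1 ≤ (2 * Real.pi) ^ m :=
  one_le_pow₀ (by linarith [Real.pi_gt_three])

theorem two_pi_pow_mul_lintegral_fourierTransform (u : L2 d m) :
    ENNReal.ofReal ((2 * Real.pi) ^ m) *
      ∫⁻ p : Freq d m, ‖fourierTransform u p.1 p.2‖ₑ ^ 2 ∂(freqMeasure d m) = ‖u‖ₑ ^ 2 := by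
  rw [lintegral_freqMeasure ((measurable_fourierTransform u).enorm.pow_const 2)]
  exact plancherel u

theorem memLp_fourierTransform (u : L2 d m) :
    MemLp (fun p : Freq d m => fourierTransform u p.1 p.2) 2 (freqMeasure d m) := by
  refine memLp_two_of_lintegral_enorm_sq_lt_top
    (measurable_fourierTransform u).aestronglyMeasurable ?_
  refine lt_of_le_of_lt ?_ (ENNReal.pow_lt_top (n := 2) (enorm_lt_top (x := u)))
  rw [← two_pi_pow_mul_lintegral_fourierTransform]
  exact le_mul_of_one_le_left zero_le (ENNReal.one_le_ofReal.2 (one_le_two_pi_pow m))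

/-- The Fourier transform as a bounded operator from `L²(ℝ^d × 𝕋^m)` to `L²(ℤ^m × ℝ^d)`. With these
normalizations it is `(2π)^{-m/2}` times an isometry. -/
noncomputable def fourierCLM (d m : ℕ) : L2 d m →L[ℂ] Lp ℂ 2 (freqMeasure d m) :=
  LinearMap.mkContinuous
    { toFun := fun u => (memLp_fourierTransform u).toLp
      map_add' := fun u v => by
        rw [← MemLp.toLp_add]
        refine MemLp.toLp_congr _ _ (ae_eq_freqMeasure (measurable_fourierTransform _)
          ((measurable_fourierTransform u).add (measurable_fourierTransform v)) fun k => ?_)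
        simp only [Pi.add_apply]
        rw [fourierTransform_add]
        exact Lp.coeFn_add _ _
      map_smul' := fun c u => by
        rw [RingHom.id_apply, ← MemLp.toLp_const_smul]
        refine MemLp.toLp_congr _ _ (ae_eq_freqMeasure (measurable_fourierTransform _)
          ((measurable_fourierTransform u).const_smul c) fun k => ?_)
        simp only [Pi.smul_apply]
        rw [fourierTransform_smul]
        exact Lp.coeFn_smul _ _ } 1 fun u => by
    have h1 : ‖(memLp_fourierTransform u).toLp‖ₑ ^ 2 ≤ ‖u‖ₑ ^ 2 := by
      rw [← two_pi_pow_mul_lintegral_fourierTransform u, ← lintegral_enorm_sq_eq]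
      refine le_trans (le_of_eq ?_) (le_mul_of_one_le_left zero_le
        (ENNReal.one_le_ofReal.2 (one_le_two_pi_pow m)))
      refine lintegral_congr_ae ?_
      filter_upwards [(memLp_fourierTransform u).coeFn_toLp] with p hp
      rw [hp]
    rw [← ofReal_norm, ← ofReal_norm, ← ENNReal.ofReal_pow (norm_nonneg _),
      ← ENNReal.ofReal_pow (norm_nonneg _), ENNReal.ofReal_le_ofReal_iff (by positivity)] at h1
    rw [one_mul]
    exact (sq_le_sq₀ (norm_nonneg _) (norm_nonneg _)).1 h1

theorem fourierCLM_ae (u : L2 d m) :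
    fourierCLM d m u =ᵐ[freqMeasure d m] fun p => fourierTransform u p.1 p.2 :=
  (memLp_fourierTransform u).coeFn_toLp

/-- The symbol of `(-Δ)^{σ/2}` as a function on frequency space. -/
noncomputable def fracSymbol (d m : ℕ) (σ : ℝ) (p : Freq d m) : ℝ :=
  laplaceSymbol p.2 p.1 ^ (σ / 2)

theorem fracSymbol_nonneg (σ : ℝ) (p : Freq d m) : 0 ≤ fracSymbol d m σ p :=
  Real.rpow_nonneg (laplaceSymbol_nonneg _ _) _

theorem measurable_fracSymbol (σ : ℝ) : Measurable (fracSymbol d m σ) :=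
  measurable_laplaceSymbol.pow_const _

theorem fracLaplaceNormSq_eq_lintegral (σ : ℝ) (u : L2 d m) :
    fracLaplaceNormSq σ u = ENNReal.ofReal ((2 * Real.pi) ^ m) *
      ∫⁻ p, ‖(fracSymbol d m σ p : ℂ) * fourierCLM d m u p‖ₑ ^ 2 ∂(freqMeasure d m) := by
  have h1 : ∫⁻ p, ‖(fracSymbol d m σ p : ℂ) * fourierCLM d m u p‖ₑ ^ 2 ∂(freqMeasure d m) =
      ∫⁻ p : Freq d m, ENNReal.ofReal (laplaceSymbol p.2 p.1 ^ σ) *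
        ‖fourierTransform u p.1 p.2‖ₑ ^ 2 ∂(freqMeasure d m) := by
    refine lintegral_congr_ae ?_
    filter_upwards [fourierCLM_ae u] with p hp
    rw [hp, enorm_mul, mul_pow, ← ofReal_norm (fracSymbol d m σ p : ℂ), Complex.norm_real,
      Real.norm_of_nonneg (fracSymbol_nonneg σ p), ← ENNReal.ofReal_pow (fracSymbol_nonneg σ p),
      fracSymbol, ← Real.rpow_natCast, ← Real.rpow_mul (laplaceSymbol_nonneg _ _)]
    norm_num
  rw [h1]
  exact congrArg _ (lintegral_freqMeasure
    (((measurable_laplaceSymbol.pow_const σ).ennreal_ofReal).mul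
      ((measurable_fourierTransform u).enorm.pow_const 2))).symm

theorem fracLaplaceNormSq_eq_enorm_sq {σ : ℝ} {u : L2 d m} {y : Lp ℂ 2 (freqMeasure d m)}
    (hy : y =ᵐ[freqMeasure d m] fun p => (fracSymbol d m σ p : ℂ) * fourierCLM d m u p) :
    fracLaplaceNormSq σ u = ENNReal.ofReal ((2 * Real.pi) ^ m) * ‖y‖ₑ ^ 2 := by
  rw [fracLaplaceNormSq_eq_lintegral, ← lintegral_enorm_sq_eq]
  congr 1
  refine lintegral_congr_ae ?_
  filter_upwards [hy] with p hp
  rw [hp]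

/-- If `‖(-Δ)^{σ/2} u‖₂` is finite, then the symbol times the Fourier transform of `u` is an element of
`L²`. -/
theorem exists_fracSymbol_mul_fourier {σ : ℝ} {u : L2 d m} (hu : fracLaplaceNormSq σ u < ∞) :
    ∃ y : Lp ℂ 2 (freqMeasure d m),
      y =ᵐ[freqMeasure d m] fun p => (fracSymbol d m σ p : ℂ) * fourierCLM d m u p := by
  have hmem : MemLp (fun p => (fracSymbol d m σ p : ℂ) * fourierCLM d m u p) 2
      (freqMeasure d m) := by
    refine memLp_two_of_lintegral_enorm_sq_lt_top ?_ ?_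
    · exact ((Complex.measurable_ofReal.comp (measurable_fracSymbol σ)).mul
        (Lp.stronglyMeasurable _).measurable).aestronglyMeasurable
    · refine lt_of_le_of_lt ?_ hu
      rw [fracLaplaceNormSq_eq_lintegral]
      exact le_mul_of_one_le_left zero_le (ENNReal.one_le_ofReal.2 (one_le_two_pi_pow m))
  exact ⟨hmem.toLp, hmem.coeFn_toLp⟩

/-- Multiplication by the symbol `w` of `(-Δ)^{σ/2}` is weakly closed: apply the bounded
multipliers `1 / (1 + w)` and `w / (1 + w)`. -/
theorem fracSymbol_mul_of_weakTendsto {σ : ℝ} {x : ℕ → L2 d m} {v : L2 d m}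
    {y : ℕ → Lp ℂ 2 (freqMeasure d m)} {z : Lp ℂ 2 (freqMeasure d m)}
    (hxy : ∀ n, y n =ᵐ[freqMeasure d m]
      fun p => (fracSymbol d m σ p : ℂ) * fourierCLM d m (x n) p)
    (hx : WeakTendsto x v) (hy : WeakTendsto y z) :
    z =ᵐ[freqMeasure d m] fun p => (fracSymbol d m σ p : ℂ) * fourierCLM d m v p := by
  have hw := measurable_fracSymbol (d := d) (m := m) σ
  have hw0 := fracSymbol_nonneg (d := d) (m := m) σ
  set a : Freq d m → ℂ := fun p => ((1 / (1 + fracSymbol d m σ p) : ℝ) : ℂ) with ha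
  set b : Freq d m → ℂ := fun p =>
    ((fracSymbol d m σ p / (1 + fracSymbol d m σ p) : ℝ) : ℂ) with hb
  have ham : MemLp a ∞ (freqMeasure d m) := by
    refine memLp_top_of_bound (Complex.measurable_ofReal.comp
      (measurable_const.div (measurable_const.add hw))).aestronglyMeasurable 1
      (.of_forall fun p => ?_)
    have := hw0 p
    rw [ha, Complex.norm_real, Real.norm_of_nonneg (by positivity), div_le_one (by positivity)]
    linarith
  have hbm : MemLp b ∞ (freqMeasure d m) := by
    refine memLp_top_of_bound (Complex.measurable_ofReal.comp
      (hw.div (measurable_const.add hw))).aestronglyMeasurable 1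
      (.of_forall fun p => ?_)
    have := hw0 p
    rw [hb, Complex.norm_real, Real.norm_of_nonneg (by positivity), div_le_one (by positivity)]
    linarith
  obtain ⟨A, hA⟩ := exists_continuousLinearMap_mul ham
  obtain ⟨B, hB⟩ := exists_continuousLinearMap_mul hbm
  have hab : ∀ p, b p = a p * fracSymbol d m σ p := fun p => by
    simp only [ha, hb]; push_cast; ring
  have hn : ∀ n, A (y n) = B (fourierCLM d m (x n)) := by
    intro n
    ext1
    filter_upwards [hA (y n), hB (fourierCLM d m (x n)), hxy n] with p h1 h2 h3
    rw [h1, h2, h3, hab, mul_assoc]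
  have hlim : A z = B (fourierCLM d m v) := by
    refine WeakTendsto.unique (hy.map A) ?_
    simp only [hn]
    exact (hx.map (fourierCLM d m)).map B
  have hz := hA z
  rw [hlim] at hz
  filter_upwards [hz, hB (fourierCLM d m v)] with p h1 h2
  rw [h2, hab, mul_assoc] at h1
  have ha0 : a p ≠ 0 := by
    have := hw0 p
    rw [ha]
    exact Complex.ofReal_ne_zero.2 (by positivity)
  exact (mul_left_cancel₀ ha0 h1).symm

/-- Weak compactness in `H^σ`, with the asymptotic splitting of `‖(-Δ)^{σ/2} u‖₂²`. -/
theorem exists_weakTendsto_sobolev {σ : ℝ} {u : ℕ → L2 d m} {M K : ℝ} (hM : ∀ n, ‖u n‖ ^ 2 ≤ M)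
    (hK : ∀ n, fracLaplaceNormSq σ (u n) ≤ ENNReal.ofReal K) :
    ∃ (v : L2 d m) (φ : ℕ → ℕ), StrictMono φ ∧ WeakTendsto (u ∘ φ) v ∧
      fracLaplaceNormSq σ v < ∞ ∧ (∀ n, fracLaplaceNormSq σ (u (φ n) - v) < ∞) ∧
      Filter.Tendsto (fun n => (fracLaplaceNormSq σ (u (φ n))).toReal -
        (fracLaplaceNormSq σ (u (φ n) - v)).toReal) Filter.atTop
        (nhds (fracLaplaceNormSq σ v).toReal) := by
  have : Fact ((2 : ℝ≥0∞) ≠ ∞) := ⟨by norm_num⟩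
  have : IsSeparable (volume : Measure (Domain d m)) :=
    isSeparable_of_sigmaFinite _
  have hpos : 0 < (2 * Real.pi) ^ m := pow_pos Real.two_pi_pos m
  choose y hy using fun n => exists_fracSymbol_mul_fourier ((hK n).trans_lt ENNReal.ofReal_lt_top)
  have hy' : ∀ n, ‖y n‖ ≤ max K 1 := by
    intro n
    have h1 := hK n
    rw [fracLaplaceNormSq_eq_enorm_sq (hy n), ← ofReal_norm, ← ENNReal.ofReal_pow (norm_nonneg _),
      ← ENNReal.ofReal_mul hpos.le] at h1
    have h2 := (ENNReal.ofReal_le_ofReal_iff (by positivity)).1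
      (h1.trans (ENNReal.ofReal_le_ofReal (le_max_left K 1)))
    have h3 := le_max_right K 1
    have h4 : ‖y n‖ ^ 2 ≤ max K 1 :=
      (le_mul_of_one_le_left (sq_nonneg _) (one_le_two_pi_pow m)).trans h2
    nlinarith [norm_nonneg (y n)]
  have hu' : ∀ n, ‖u n‖ ≤ max M 1 := by
    intro n
    have h3 := le_max_right M 1
    have h4 : ‖u n‖ ^ 2 ≤ max M 1 := (hM n).trans (le_max_left _ _)
    nlinarith [norm_nonneg (u n)]
  obtain ⟨v, φ, hφ, hv⟩ := exists_weakTendsto_subseq hu'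
  obtain ⟨z, ψ, hψ, hz⟩ := exists_weakTendsto_subseq (x := y ∘ φ) fun n => hy' (φ n)
  have hv' := hv.comp hψ
  have hzv := fracSymbol_mul_of_weakTendsto (x := (u ∘ φ) ∘ ψ) (fun n => hy (φ (ψ n))) hv' hz
  have hsub : ∀ n, (y (φ (ψ n)) - z : Lp ℂ 2 (freqMeasure d m)) =ᵐ[freqMeasure d m]
      fun p => (fracSymbol d m σ p : ℂ) * fourierCLM d m (u (φ (ψ n)) - v) p := by
    intro n
    rw [map_sub]
    filter_upwards [Lp.coeFn_sub (y (φ (ψ n))) z, hy (φ (ψ n)), hzv,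
      Lp.coeFn_sub (fourierCLM d m (u (φ (ψ n)))) (fourierCLM d m v)] with p h1 h2 h3 h4
    rw [h1, h4, Pi.sub_apply, Pi.sub_apply, h2, h3, mul_sub]
  have hfin : ∀ y : Lp ℂ 2 (freqMeasure d m),
      ENNReal.ofReal ((2 * Real.pi) ^ m) * ‖y‖ₑ ^ 2 < ∞ := fun y =>
    ENNReal.mul_lt_top ENNReal.ofReal_lt_top (ENNReal.pow_lt_top enorm_lt_top)
  have hreal : ∀ y : Lp ℂ 2 (freqMeasure d m),
      (ENNReal.ofReal ((2 * Real.pi) ^ m) * ‖y‖ₑ ^ 2).toReal = (2 * Real.pi) ^ m * ‖y‖ ^ 2 := by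
    intro y
    rw [ENNReal.toReal_mul, ENNReal.toReal_ofReal hpos.le, ENNReal.toReal_pow, toReal_enorm]
  refine ⟨v, φ ∘ ψ, hφ.comp hψ, hv', ?_, fun n => ?_, ?_⟩
  · rw [fracLaplaceNormSq_eq_enorm_sq hzv]
    exact hfin z
  · simp only [Function.comp_apply]
    rw [fracLaplaceNormSq_eq_enorm_sq (hsub n)]
    exact hfin _
  · have h := hz.norm_sq_sub.const_mul ((2 * Real.pi) ^ m)
    rw [fracLaplaceNormSq_eq_enorm_sq hzv, hreal]
    refine h.congr fun n => ?_
    simp only [Function.comp_apply]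
    rw [fracLaplaceNormSq_eq_enorm_sq (hsub n), fracLaplaceNormSq_eq_enorm_sq (hy _), hreal, hreal]
    ring

/-! ### Almost everywhere convergence and the Brezis–Lieb inequality -/

open Filter Topology

theorem WeakTendsto.tendsto_ballAverage {x : ℕ → L2 d m} {v : L2 d m} (h : WeakTendsto x v)
    (r : ℝ) (p : Domain d m) :
    Tendsto (fun n => ballAverage r (x n) p) atTop (𝓝 (ballAverage r v p)) := by
  have hs : MeasurableSet (Metric.closedBall p r) := Metric.isClosed_closedBall.measurableSet
  have h1 := h (indicatorConstLp 2 hs (volume_closedBall_domain_lt_top p r).ne (1 : ℂ))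
  simp only [L2.inner_indicatorConstLp_one] at h1
  simp only [ballAverage, setAverage_eq]
  exact h1.const_smul _

theorem stronglyMeasurable_ballAverage (r : ℝ) (u : L2 d m) :
    StronglyMeasurable (ballAverage r u) := by
  have hum : Measurable (u : Domain d m → ℂ) := (Lp.stronglyMeasurable u).measurable
  have h1 : StronglyMeasurable (Function.uncurry fun p h : Domain d m => u (p + h)) := by
    have : Measurable (Function.uncurry fun p h : Domain d m => u (p + h)) := by
      unfold Function.uncurry
      fun_prop
    exact this.stronglyMeasurable
  have h2 : ballAverage r u = fun p => (volume.real (Metric.closedBall (0 : Domain d m) r))⁻¹ •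
      ∫ h in Metric.closedBall (0 : Domain d m) r, u (p + h) := by
    funext p
    rw [ballAverage_eq, setAverage_eq]
  rw [h2]
  have h3 : StronglyMeasurable fun p => ∫ h in Metric.closedBall (0 : Domain d m) r, u (p + h) :=
    h1.integral_prod_right
  exact h3.const_smul (volume.real (Metric.closedBall (0 : Domain d m) r))⁻¹

/-- Local compactness of `H^σ` in weighted form: a sequence which is bounded in `H^σ` and weakly null
in `L²` tends to zero in `L²` with respect to any finite measure with bounded density. Its averages over
balls tend to zero pointwise and are bounded, and they are uniformly close to the sequence in `L²`. -/
theorem tendsto_lintegral_weight_of_weakTendsto_zero {σ : ℝ} (hσ0 : 0 < σ) (hσ1 : σ < 1)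
    {w : ℕ → L2 d m} (hw : WeakTendsto w 0) {M K : ℝ} (hM : ∀ n, ‖w n‖ ^ 2 ≤ M)
    (hK : ∀ n, fracLaplaceNormSq σ (w n) ≤ ENNReal.ofReal K) {g : Domain d m → ℝ≥0∞}
    (hg : Measurable g) (hg1 : ∀ p, g p ≤ 1) (hgi : ∫⁻ p, g p ≠ ∞) :
    Tendsto (fun n => ∫⁻ p, g p * ‖w n p‖ₑ ^ 2) atTop (𝓝 0) := by
  rw [ENNReal.tendsto_nhds_zero]
  intro ε hε
  set K' : ℝ := max K 1 with hK'
  have hK'0 : 0 < K' := lt_of_lt_of_le one_pos (le_max_right _ _)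
  obtain ⟨e, he0, heε⟩ : ∃ e : ℝ, 0 < e ∧ ENNReal.ofReal e ≤ ε := by
    rcases eq_or_ne ε ∞ with h | h
    · exact ⟨1, one_pos, h ▸ le_top⟩
    · exact ⟨ε.toReal, ENNReal.toReal_pos hε.ne' h, (ENNReal.ofReal_toReal h).le⟩
  obtain ⟨r, hr, hr0⟩ : ∃ r : ℝ, 2 * (4 * ((m + 1) * r ^ 2) ^ σ * K') ≤ e / 2 ∧ 0 < r := by
    have h1 : Tendsto (fun r : ℝ => 2 * (4 * ((m + 1) * r ^ 2) ^ σ * K')) (𝓝[>] 0) (𝓝 0) := by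
      have : ContinuousAt (fun r : ℝ => 2 * (4 * ((m + 1) * r ^ 2) ^ σ * K')) 0 := by
        refine continuousAt_const.mul ((continuousAt_const.mul ?_).mul_const _)
        exact (continuousAt_const.mul (continuousAt_id.pow 2)).rpow_const (Or.inr hσ0.le)
      have h2 := this.tendsto
      simp only [ne_eq, OfNat.ofNat_ne_zero, not_false_eq_true, zero_pow, mul_zero,
        Real.zero_rpow hσ0.ne', zero_mul] at h2
      exact h2.mono_left nhdsWithin_le_nhds
    exact ((h1.eventually (ge_mem_nhds (by positivity))).and self_mem_nhdsWithin).exists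
  set B : ℝ≥0∞ := (volume (Metric.closedBall (0 : Domain d m) r))⁻¹ * ENNReal.ofReal M with hB
  have hBt : B ≠ ∞ := ENNReal.mul_ne_top
    (ENNReal.inv_ne_top.2 (volume_closedBall_domain_pos 0 hr0).ne') ENNReal.ofReal_ne_top
  have hzero : ∀ p, ballAverage r ((0 : L2 d m) : Domain d m → ℂ) p = 0 := fun p => by
    have h := enorm_ballAverage_sq_le hr0 (0 : L2 d m) p
    simpa using h
  have havg : Tendsto (fun n => ∫⁻ p, g p * ‖ballAverage r (w n) p‖ₑ ^ 2) atTop (𝓝 0) := by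
    have h1 := tendsto_lintegral_of_dominated_convergence (μ := (volume : Measure (Domain d m)))
      (F := fun n p => g p * ‖ballAverage r (w n) p‖ₑ ^ 2) (f := fun _ => 0) (fun p => g p * B)
      (fun n => hg.mul ((stronglyMeasurable_ballAverage r (w n)).measurable.enorm.pow_const 2))
      (fun n => .of_forall fun p => by
        change g p * ‖ballAverage r (w n) p‖ₑ ^ 2 ≤ g p * B
        gcongr
        refine (enorm_ballAverage_sq_le hr0 (w n) p).trans ?_
        rw [volume_closedBall_domain_eq, hB, ← ofReal_norm, ← ENNReal.ofReal_pow (norm_nonneg _)]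
        gcongr
        exact hM n)
      (by rw [lintegral_mul_const' _ _ hBt]; exact ENNReal.mul_ne_top hgi hBt)
      (.of_forall fun p => by
        have h2 := ((ENNReal.continuous_pow 2).tendsto _).comp (hw.tendsto_ballAverage r p).enorm
        rw [hzero p] at h2
        have h3 := ENNReal.Tendsto.const_mul (a := g p) h2
          (Or.inr ((hg1 p).trans_lt ENNReal.one_lt_top).ne)
        simpa [Function.comp_def] using h3)
    simpa using h1
  have hev := ENNReal.tendsto_nhds_zero.1 havg (ENNReal.ofReal (e / 4))
    (ENNReal.ofReal_pos.2 (by positivity))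
  filter_upwards [hev] with n hn
  have hum : Measurable (w n : Domain d m → ℂ) := (Lp.stronglyMeasurable (w n)).measurable
  have hpt : ∀ p, g p * ‖w n p‖ₑ ^ 2 ≤ ENNReal.ofReal 2 * ‖w n p - ballAverage r (w n) p‖ₑ ^ 2 +
      ENNReal.ofReal 2 * (g p * ‖ballAverage r (w n) p‖ₑ ^ 2) := by
    intro p
    have h1 : ‖w n p‖ₑ ^ 2 ≤ ENNReal.ofReal 2 * ‖w n p - ballAverage r (w n) p‖ₑ ^ 2 +
        ENNReal.ofReal 2 * ‖ballAverage r (w n) p‖ₑ ^ 2 := by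
      simp only [← ofReal_norm, ← ENNReal.ofReal_pow (norm_nonneg _)]
      rw [← ENNReal.ofReal_mul (by norm_num), ← ENNReal.ofReal_mul (by norm_num),
        ← ENNReal.ofReal_add (by positivity) (by positivity)]
      refine ENNReal.ofReal_le_ofReal ?_
      have h2 : ‖w n p‖ ≤ ‖w n p - ballAverage r (w n) p‖ + ‖ballAverage r (w n) p‖ := by
        simpa using norm_add_le (w n p - ballAverage r (w n) p) (ballAverage r (w n) p)
      have h3 := norm_nonneg (w n p)
      nlinarith [sq_nonneg (‖w n p - ballAverage r (w n) p‖ - ‖ballAverage r (w n) p‖)]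
    refine (mul_le_mul_right h1 (g p)).trans ?_
    rw [mul_add]
    refine add_le_add (mul_le_of_le_one_left zero_le (hg1 p)) (le_of_eq ?_)
    rw [mul_left_comm]
  calc ∫⁻ p, g p * ‖w n p‖ₑ ^ 2
      ≤ ENNReal.ofReal 2 * (∫⁻ p, ‖w n p - ballAverage r (w n) p‖ₑ ^ 2) +
        ENNReal.ofReal 2 * ∫⁻ p, g p * ‖ballAverage r (w n) p‖ₑ ^ 2 := by
        rw [← lintegral_const_mul' _ _ ENNReal.ofReal_ne_top,
          ← lintegral_const_mul' _ _ ENNReal.ofReal_ne_top, ← lintegral_add_left]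
        · exact lintegral_mono hpt
        · exact ((hum.sub (stronglyMeasurable_ballAverage r (w n)).measurable).enorm.pow_const
            2).const_mul _
    _ ≤ ENNReal.ofReal 2 * (ENNReal.ofReal (4 * ((m + 1) * r ^ 2) ^ σ) * ENNReal.ofReal K') +
        ENNReal.ofReal 2 * ENNReal.ofReal (e / 4) := by
        gcongr
        refine (lintegral_enorm_sub_ballAverage_sq_le hσ0 hσ1 hr0 (w n)).trans ?_
        gcongr
        exact (hK n).trans (ENNReal.ofReal_le_ofReal (le_max_left _ _))
    _ ≤ ENNReal.ofReal e := by
        rw [← ENNReal.ofReal_mul (by positivity), ← ENNReal.ofReal_mul (by positivity),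
          ← ENNReal.ofReal_mul (by positivity), ← ENNReal.ofReal_add (by positivity)
          (by positivity)]
        refine ENNReal.ofReal_le_ofReal ?_
        linarith
    _ ≤ ε := heε

/-- A sequence which is bounded in `H^σ` and weakly null in `L²` has a subsequence which tends to zero
almost everywhere. -/
theorem exists_subseq_ae_tendsto_zero {σ : ℝ} (hσ0 : 0 < σ) (hσ1 : σ < 1)
    {w : ℕ → L2 d m} (hw : WeakTendsto w 0) {M K : ℝ} (hM : ∀ n, ‖w n‖ ^ 2 ≤ M)
    (hK : ∀ n, fracLaplaceNormSq σ (w n) ≤ ENNReal.ofReal K) :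
    ∃ φ : ℕ → ℕ, StrictMono φ ∧ ∀ᵐ p, Tendsto (fun n => w (φ n) p) atTop (𝓝 0) := by
  obtain ⟨g, hg0, hgm, hgi⟩ := exists_pos_lintegral_lt_of_sigmaFinite
    (volume : Measure (Domain d m)) one_ne_zero
  set f : Domain d m → ℝ≥0∞ := fun p => min (g p : ℝ≥0∞) 1 with hf
  have hfm : Measurable f := hgm.coe_nnreal_ennreal.min measurable_const
  have hfi : ∫⁻ p, f p ≠ ∞ :=
    ((lintegral_mono fun p => min_le_left _ _).trans_lt (hgi.trans ENNReal.one_lt_top)).ne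
  have hlim := tendsto_lintegral_weight_of_weakTendsto_zero hσ0 hσ1 hw hM hK hfm
    (fun p => min_le_right _ _) hfi
  set μ := (volume : Measure (Domain d m)).withDensity f with hμ
  have hm0 : ∀ n, AEStronglyMeasurable (w n : Domain d m → ℂ) μ := fun n =>
    (Lp.stronglyMeasurable (w n)).aestronglyMeasurable
  have h2 : Tendsto (fun n => eLpNorm ((w n : Domain d m → ℂ) - fun _ => (0 : ℂ)) 2 μ) atTop
      (𝓝 0) := by
    have h3 : ∀ n, eLpNorm ((w n : Domain d m → ℂ) - fun _ => (0 : ℂ)) 2 μ =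
        (∫⁻ p, f p * ‖w n p‖ₑ ^ 2) ^ (1 / 2 : ℝ) := by
      intro n
      rw [eLpNorm_eq_lintegral_rpow_enorm_toReal (by norm_num) (by norm_num), hμ,
        lintegral_withDensity_eq_lintegral_mul _ hfm (by
          simp only [Pi.sub_apply, sub_zero]
          exact (Lp.stronglyMeasurable (w n)).measurable.enorm.pow_const _)]
      simp
    simp only [h3]
    have h4 := (ENNReal.continuous_rpow_const (y := (1 / 2 : ℝ))).tendsto 0
    rw [ENNReal.zero_rpow_of_pos (by norm_num)] at h4
    exact h4.comp hlim
  have h5 := tendstoInMeasure_of_tendsto_eLpNorm (by norm_num) hm0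
    aestronglyMeasurable_const h2
  obtain ⟨φ, hφ, hae⟩ := h5.exists_seq_tendsto_ae
  refine ⟨φ, hφ, ?_⟩
  have hac : (volume : Measure (Domain d m)) ≪ μ :=
    withDensity_absolutelyContinuous' hfm.aemeasurable (.of_forall fun p => by
      have := hg0 p
      simp only [hf]
      positivity)
  exact hac.ae_le hae

/-- Convexity of `s ↦ s ^ q`, applied to `|a| + |b| = t (|a| / t) + (1 - t) (|b| / (1 - t))`. -/
theorem enorm_add_rpow_le {q : ℝ} (hq : 1 ≤ q) {t : ℝ} (ht0 : 0 < t) (ht1 : t < 1) (a b : ℂ) :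
    ‖a + b‖ₑ ^ q ≤ ENNReal.ofReal (t ^ (1 - q)) * ‖a‖ₑ ^ q +
      ENNReal.ofReal ((1 - t) ^ (1 - q)) * ‖b‖ₑ ^ q := by
  have hs : 0 < 1 - t := by linarith
  simp only [← ofReal_norm]
  rw [ENNReal.ofReal_rpow_of_nonneg (norm_nonneg _) (by linarith),
    ENNReal.ofReal_rpow_of_nonneg (norm_nonneg _) (by linarith),
    ENNReal.ofReal_rpow_of_nonneg (norm_nonneg _) (by linarith),
    ← ENNReal.ofReal_mul (by positivity), ← ENNReal.ofReal_mul (by positivity),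
    ← ENNReal.ofReal_add (by positivity) (by positivity)]
  refine ENNReal.ofReal_le_ofReal ?_
  have h1 := (convexOn_rpow hq).2 (x := ‖a‖ / t) (y := ‖b‖ / (1 - t)) (Set.mem_Ici.2 (by positivity))
    (Set.mem_Ici.2 (by positivity)) ht0.le hs.le (by ring)
  simp only [smul_eq_mul] at h1
  have h2 : ∀ s x : ℝ, 0 < s → 0 ≤ x → s * (x / s) ^ q = s ^ (1 - q) * x ^ q := by
    intro s x hs hx
    rw [Real.div_rpow hx hs.le, Real.rpow_sub hs, Real.rpow_one]
    ring
  rw [h2 _ _ ht0 (norm_nonneg _), h2 _ _ hs (norm_nonneg _), mul_div_cancel₀ _ ht0.ne',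
    mul_div_cancel₀ _ hs.ne'] at h1
  refine le_trans ?_ h1
  gcongr
  exact norm_add_le a b

/-- One half of the Brezis–Lieb lemma: `∫ |w_n + v|^q ≤ t ^ (1 - q) ∫ |w_n|^q + ∫ |v|^q + o(1)` for every
`t < 1`. Fatou's lemma is applied to the nonnegative functions
`t ^ (1 - q) |w_n|^q + (1 - t) ^ (1 - q) |v|^q - |w_n + v|^q`. -/
theorem eventually_lintegral_add_rpow_le {β : Type*} [MeasurableSpace β] {μ : Measure β} {q : ℝ}
    (hq : 1 ≤ q) {t : ℝ} (ht0 : 0 < t) (ht1 : t < 1)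
    {w : ℕ → β → ℂ} {v : β → ℂ} (hw : ∀ n, AEMeasurable (w n) μ) (hv : AEMeasurable v μ)
    (hwv : ∀ᵐ p ∂μ, Tendsto (fun n => w n p) atTop (𝓝 0))
    (hwi : ∀ n, ∫⁻ p, ‖w n p‖ₑ ^ q ∂μ ≠ ∞) (hvi : ∫⁻ p, ‖v p‖ₑ ^ q ∂μ ≠ ∞) {δ : ℝ} (hδ : 0 < δ) :
    ∀ᶠ n in atTop, (∫⁻ p, ‖w n p + v p‖ₑ ^ q ∂μ).toReal ≤
      t ^ (1 - q) * (∫⁻ p, ‖w n p‖ₑ ^ q ∂μ).toReal + (∫⁻ p, ‖v p‖ₑ ^ q ∂μ).toReal + δ := by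
  have hs : 0 < 1 - t := by linarith
  have hq0 : 0 < q := by linarith
  set A := ENNReal.ofReal (t ^ (1 - q)) with hA
  set C := ENNReal.ofReal ((1 - t) ^ (1 - q)) with hC
  have hC1 : 1 ≤ (1 - t) ^ (1 - q) := Real.one_le_rpow_of_pos_of_le_one_of_nonpos hs
    (by linarith) (by linarith)
  set F : ℕ → β → ℝ≥0∞ := fun n p => A * ‖w n p‖ₑ ^ q + C * ‖v p‖ₑ ^ q - ‖w n p + v p‖ₑ ^ q with hF
  have hFm : ∀ n, AEMeasurable (F n) μ := fun n =>
    (((hw n).enorm.pow_const q).const_mul A |>.add ((hv.enorm.pow_const q).const_mul C)).sub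
      (((hw n).add hv).enorm.pow_const q)
  have hle : ∀ n p, ‖w n p + v p‖ₑ ^ q ≤ A * ‖w n p‖ₑ ^ q + C * ‖v p‖ₑ ^ q := fun n p =>
    enorm_add_rpow_le hq ht0 ht1 _ _
  have htop : ∀ z : ℂ, ‖z‖ₑ ^ q ≠ ∞ := fun z =>
    ENNReal.rpow_ne_top_of_nonneg hq0.le enorm_ne_top
  have hliminf : ∀ᵐ p ∂μ, liminf (fun n => F n p) atTop = C * ‖v p‖ₑ ^ q - ‖v p‖ₑ ^ q := by
    filter_upwards [hwv] with p hp
    have hc : Tendsto (fun n => ‖w n p‖ₑ ^ q) atTop (𝓝 0) := by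
      have h1 := ((ENNReal.continuous_rpow_const (y := q)).tendsto _).comp hp.enorm
      simpa [ENNReal.zero_rpow_of_pos hq0, Function.comp_def] using h1
    have hc2 : Tendsto (fun n => ‖w n p + v p‖ₑ ^ q) atTop (𝓝 (‖v p‖ₑ ^ q)) := by
      have h1 := ((ENNReal.continuous_rpow_const (y := q)).tendsto _).comp
        (hp.add_const (v p)).enorm
      simpa [Function.comp_def] using h1
    have h3 : Tendsto (fun n => A * ‖w n p‖ₑ ^ q + C * ‖v p‖ₑ ^ q) atTop
        (𝓝 (C * ‖v p‖ₑ ^ q)) := by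
      have h4 := (ENNReal.Tendsto.const_mul (a := A) hc (Or.inr ENNReal.ofReal_ne_top)).add_const
        (C * ‖v p‖ₑ ^ q)
      simpa using h4
    have h5 : Tendsto (fun n => F n p) atTop (𝓝 (C * ‖v p‖ₑ ^ q - ‖v p‖ₑ ^ q)) :=
      ENNReal.Tendsto.sub h3 hc2 (Or.inr (htop _))
    exact h5.liminf_eq
  have hfatou := lintegral_liminf_le' (μ := μ) (f := F) (u := atTop) hFm
  rw [lintegral_congr_ae hliminf] at hfatou
  set V := ∫⁻ p, ‖v p‖ₑ ^ q ∂μ with hV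
  have hsubV : ∫⁻ p, (C * ‖v p‖ₑ ^ q - ‖v p‖ₑ ^ q) ∂μ = C * V - V := by
    rw [lintegral_sub' (hv.enorm.pow_const q) hvi (.of_forall fun p =>
      le_mul_of_one_le_left zero_le (ENNReal.one_le_ofReal.2 hC1)),
      lintegral_const_mul' _ _ ENNReal.ofReal_ne_top]
  rw [hsubV] at hfatou
  have hint : ∀ n, ∫⁻ p, F n p ∂μ + ∫⁻ p, ‖w n p + v p‖ₑ ^ q ∂μ =
      A * ∫⁻ p, ‖w n p‖ₑ ^ q ∂μ + C * V := by
    intro n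
    have hUm : AEMeasurable (fun p => ‖w n p + v p‖ₑ ^ q) μ :=
      ((hw n).add hv).enorm.pow_const q
    rw [← lintegral_add_right' _ hUm,
      ← lintegral_const_mul' _ _ ENNReal.ofReal_ne_top, hV,
      ← lintegral_const_mul' _ _ ENNReal.ofReal_ne_top,
      ← lintegral_add_right' _ ((hv.enorm.pow_const q).const_mul C)]
    exact lintegral_congr fun p => tsub_add_cancel_of_le (hle n p)
  have hfinR : ∀ n, A * ∫⁻ p, ‖w n p‖ₑ ^ q ∂μ + C * V ≠ ∞ := fun n =>
    ENNReal.add_ne_top.2 ⟨ENNReal.mul_ne_top ENNReal.ofReal_ne_top (hwi n),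
      ENNReal.mul_ne_top ENNReal.ofReal_ne_top hvi⟩
  have hFi : ∀ n, ∫⁻ p, F n p ∂μ ≠ ∞ := fun n =>
    ((le_self_add.trans (hint n).le).trans_lt (hfinR n).lt_top).ne
  have hUi : ∀ n, ∫⁻ p, ‖w n p + v p‖ₑ ^ q ∂μ ≠ ∞ := fun n =>
    ((le_add_self.trans (hint n).le).trans_lt (hfinR n).lt_top).ne
  have hVle : V ≤ C * V := le_mul_of_one_le_left zero_le (ENNReal.one_le_ofReal.2 hC1)
  have hCV : C * V ≠ ∞ := ENNReal.mul_ne_top ENNReal.ofReal_ne_top hvi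
  have hev : ∀ᶠ n in atTop, (C * V - V).toReal - δ ≤ (∫⁻ p, F n p ∂μ).toReal := by
    rcases le_or_gt ((C * V - V).toReal - δ) 0 with h | h
    · exact .of_forall fun n => h.trans ENNReal.toReal_nonneg
    · have h1 : ENNReal.ofReal ((C * V - V).toReal - δ) < liminf (fun n => ∫⁻ p, F n p ∂μ) atTop := by
        refine lt_of_lt_of_le ?_ hfatou
        rw [ENNReal.ofReal_lt_iff_lt_toReal h.le (ENNReal.sub_ne_top hCV)]
        linarith
      filter_upwards [eventually_lt_of_lt_liminf h1] with n hn
      exact (ENNReal.ofReal_le_iff_le_toReal (hFi n)).1 hn.le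
  filter_upwards [hev] with n hn
  have h1 := congrArg ENNReal.toReal (hint n)
  rw [ENNReal.toReal_add (hFi n) (hUi n), ENNReal.toReal_add (ENNReal.mul_ne_top
    ENNReal.ofReal_ne_top (hwi n)) hCV, ENNReal.toReal_mul, ENNReal.toReal_ofReal
    (by positivity)] at h1
  rw [ENNReal.toReal_sub_of_le hVle hCV] at hn
  linarith

/-! ### The energy as a real number -/

/-- The real number `‖(-Δ)^{σ/2} u‖₂²`; it is only used where `fracLaplaceNormSq σ u` is finite. -/
noncomputable def kinetic (σ : ℝ) (u : L2 d m) : ℝ := (fracLaplaceNormSq σ u).toReal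

/-- The real number `‖u‖_{α+2}^{α+2}`; it is only used where the integral is finite. -/
noncomputable def potential (α : ℝ) (u : L2 d m) : ℝ := (∫⁻ p, ‖u p‖ₑ ^ (α + 2)).toReal

/-- The energy as a real number; it is the value of `energy` where both terms are finite
(`energy_eq_coe`). -/
noncomputable def realEnergy (σ α : ℝ) (u : L2 d m) : ℝ :=
  1 / 2 * kinetic σ u - 1 / (α + 2) * potential α u

theorem kinetic_nonneg (σ : ℝ) (u : L2 d m) : 0 ≤ kinetic σ u := ENNReal.toReal_nonneg

theorem potential_nonneg (α : ℝ) (u : L2 d m) : 0 ≤ potential α u := ENNReal.toReal_nonneg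

theorem energy_eq_coe {σ α : ℝ} (hα : 0 < α) {u : L2 d m} (hK : fracLaplaceNormSq σ u < ∞)
    (hP : ∫⁻ p, ‖u p‖ₑ ^ (α + 2) < ∞) :
    energy σ α u = (realEnergy σ α u : EReal) := by
  have h : ∀ (a : ℝ) (x : ℝ≥0∞), 0 ≤ a → x < ∞ →
      ((ENNReal.ofReal a * x : ℝ≥0∞) : EReal) = ((a * x.toReal : ℝ) : EReal) := by
    intro a x ha hx
    rw [← EReal.coe_ennreal_toReal (ENNReal.mul_lt_top ENNReal.ofReal_lt_top hx).ne,
      ENNReal.toReal_mul, ENNReal.toReal_ofReal ha]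
  rw [energy, h _ _ (by norm_num) hK, h _ _ (by positivity) hP, ← EReal.coe_sub]
  rfl

theorem mem_sobolev_iff {σ : ℝ} (hσ0 : 0 < σ) (hσ1 : σ < 1) (u : L2 d m) :
    u ∈ sobolev d m σ ↔ fracLaplaceNormSq σ u < ∞ := by
  constructor
  · intro h
    refine lt_of_le_of_lt ?_ h
    unfold fracLaplaceNormSq multiplierNormSq
    gcongr with k ξ
    exact Real.rpow_le_rpow (laplaceSymbol_nonneg ξ k) (by linarith) hσ0.le
  · intro h
    have hle : multiplierNormSq (fun s => (1 + s) ^ σ) u ≤ ‖u‖ₑ ^ 2 + fracLaplaceNormSq σ u := by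
      rw [← plancherel u, fracLaplaceNormSq, multiplierNormSq, multiplierNormSq, ← mul_add,
        ← ENNReal.tsum_add]
      gcongr with k
      rw [← lintegral_add_left (by fun_prop)]
      refine lintegral_mono fun ξ => ?_
      have hs := laplaceSymbol_nonneg ξ k
      have h1 : (1 + laplaceSymbol ξ k) ^ σ ≤ 1 + laplaceSymbol ξ k ^ σ := by
        have := Real.rpow_add_le_add_rpow zero_le_one hs hσ0.le hσ1.le
        rwa [Real.one_rpow] at this
      calc ENNReal.ofReal ((1 + laplaceSymbol ξ k) ^ σ) * ‖fourierTransform u k ξ‖ₑ ^ 2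
          ≤ ENNReal.ofReal (1 + laplaceSymbol ξ k ^ σ) * ‖fourierTransform u k ξ‖ₑ ^ 2 := by gcongr
        _ = _ := by
          rw [ENNReal.ofReal_add zero_le_one (Real.rpow_nonneg hs σ), ENNReal.ofReal_one, add_mul,
            one_mul]
    exact hle.trans_lt (ENNReal.add_lt_top.2 ⟨ENNReal.pow_lt_top enorm_lt_top, h⟩)

/-! ### Gaussian trial functions -/

/-- The Gaussian `exp (-b |x|²)` on `ℝ^d`. -/
noncomputable def gaussian (d : ℕ) (b : ℝ) (x : EuclideanSpace ℝ (Fin d)) : ℂ :=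
  Complex.exp (-(b : ℂ) * ‖x‖ ^ 2)

theorem norm_gaussian (b : ℝ) (x : EuclideanSpace ℝ (Fin d)) :
    ‖gaussian d b x‖ = Real.exp (-b * ‖x‖ ^ 2) := by
  rw [gaussian, Complex.norm_exp]
  congr 1
  norm_cast

theorem continuous_gaussian (b : ℝ) : Continuous (gaussian d b) := by
  unfold gaussian
  fun_prop

theorem lintegral_exp_neg_mul_sq_norm {b : ℝ} (hb : 0 < b) :
    ∫⁻ x : EuclideanSpace ℝ (Fin d), ENNReal.ofReal (Real.exp (-b * ‖x‖ ^ 2)) =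
      ENNReal.ofReal ((Real.pi / b) ^ ((d : ℝ) / 2)) := by
  have h := GaussianFourier.integral_rexp_neg_mul_sq_norm (V := EuclideanSpace ℝ (Fin d)) hb
  rw [finrank_euclideanSpace, Fintype.card_fin] at h
  rw [← h, ofReal_integral_eq_lintegral_ofReal]
  · refine not_imp_comm.1 integral_undef ?_
    rw [h]
    have := Real.pi_pos
    positivity
  · exact .of_forall fun x => (Real.exp_pos _).le

theorem lintegral_enorm_gaussian_rpow {b q : ℝ} (hb : 0 < b) (hq : 0 < q) :
    ∫⁻ x : EuclideanSpace ℝ (Fin d), ‖gaussian d b x‖ₑ ^ q =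
      ENNReal.ofReal ((Real.pi / (q * b)) ^ ((d : ℝ) / 2)) := by
  rw [← lintegral_exp_neg_mul_sq_norm (by positivity)]
  refine lintegral_congr fun x => ?_
  rw [← ofReal_norm, norm_gaussian, ENNReal.ofReal_rpow_of_nonneg (Real.exp_pos _).le hq.le,
    ← Real.exp_mul]
  congr 2
  ring

theorem memLp_gaussian {b : ℝ} (hb : 0 < b) : MemLp (gaussian d b) 2 := by
  refine memLp_two_of_lintegral_enorm_sq_lt_top (continuous_gaussian b).aestronglyMeasurable ?_
  have h := lintegral_enorm_gaussian_rpow (d := d) hb two_pos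
  simp only [ENNReal.rpow_ofNat] at h
  rw [h]
  exact ENNReal.ofReal_lt_top

theorem integrable_gaussian {b : ℝ} (hb : 0 < b) : Integrable (gaussian d b) := by
  refine ⟨(continuous_gaussian b).aestronglyMeasurable, ?_⟩
  have h := lintegral_enorm_gaussian_rpow (d := d) hb one_pos
  simp only [ENNReal.rpow_one] at h
  rw [HasFiniteIntegral, h]
  exact ENNReal.ofReal_lt_top

theorem fourier_gaussian {b : ℝ} (hb : 0 < b) : 𝓕 (gaussian d b) =
    fun ξ => (Real.pi / b : ℂ) ^ ((d : ℂ) / 2) * gaussian d (Real.pi ^ 2 / b) ξ := by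
  funext ξ
  have h := fourier_gaussian_innerProductSpace (V := EuclideanSpace ℝ (Fin d)) (b := (b : ℂ))
    (by simpa using hb) ξ
  rw [finrank_euclideanSpace, Fintype.card_fin] at h
  refine h.trans ?_
  rw [gaussian]
  congr 2
  push_cast
  ring

theorem enorm_fourier_gaussian_sq {b : ℝ} (hb : 0 < b) (ξ : EuclideanSpace ℝ (Fin d)) :
    ‖𝓕 (gaussian d b) ξ‖ₑ ^ 2 = ENNReal.ofReal ((Real.pi / b) ^ (d : ℝ) *
      Real.exp (-(2 * Real.pi * ‖ξ‖) ^ 2 / (2 * b))) := by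
  have hp : 0 < Real.pi / b := div_pos Real.pi_pos hb
  have h1 : ‖(Real.pi / b : ℂ) ^ ((d : ℂ) / 2)‖ = (Real.pi / b) ^ ((d : ℝ) / 2) := by
    have := Complex.norm_cpow_eq_rpow_re_of_pos hp ((d : ℂ) / 2)
    push_cast at this
    rw [this]
    congr 1
    simp
  rw [fourier_gaussian hb, ← ofReal_norm, ← ENNReal.ofReal_pow (norm_nonneg _), norm_mul, h1,
    norm_gaussian, mul_pow, ← Real.rpow_natCast, ← Real.rpow_mul hp.le, ← Real.exp_nat_mul]
  congr 3
  · push_cast; ring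
  · push_cast; field_simp

theorem memLp_fourier_gaussian {b : ℝ} (hb : 0 < b) : MemLp (𝓕 (gaussian d b)) 2 := by
  rw [fourier_gaussian hb]
  exact (memLp_gaussian (div_pos (pow_pos Real.pi_pos 2) hb)).const_mul _

/-- Orthogonality of characters. Parseval's identity for the constant function `1` already holds with the
term `k = 0` alone, so that all other terms vanish. -/
theorem integral_torusChar_neg {k : Fin m → ℤ} (hk : k ≠ 0) :
    ∫ y : Torus m, torusChar (-k) y = 0 := by
  have h := tsum_enorm_sq_torusChar_integral (m := m) (memLp_const (1 : ℂ))
  have h0 : ∫ y : Torus m, torusChar (-(0 : Fin m → ℤ)) y * 1 = ((2 * Real.pi) ^ m : ℝ) := by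
    simp [torusChar, Measure.real, volume_torus_univ, Real.pi_pos.le]
  have hpos : 0 < (2 * Real.pi) ^ m := pow_pos Real.two_pi_pos m
  rw [ENNReal.tsum_eq_add_tsum_ite 0, h0] at h
  simp only [enorm_one, one_pow, lintegral_one, volume_torus_univ] at h
  have h1 : ‖(((2 * Real.pi) ^ m : ℝ) : ℂ)‖ₑ ^ 2 =
      ENNReal.ofReal ((2 * Real.pi) ^ m) * ENNReal.ofReal ((2 * Real.pi) ^ m) := by
    rw [← ofReal_norm, Complex.norm_real, Real.norm_of_nonneg hpos.le, sq]
  rw [h1] at h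
  have h2 := (ENNReal.add_right_inj (by finiteness)).1 (h.trans (add_zero _).symm)
  have h3 := ENNReal.tsum_eq_zero.1 h2 k
  rw [if_neg hk] at h3
  simpa using h3

theorem lintegral_domain_fst {f : EuclideanSpace ℝ (Fin d) → ℝ≥0∞} (hf : Measurable f) :
    ∫⁻ p : Domain d m, f p.1 = ENNReal.ofReal ((2 * Real.pi) ^ m) * ∫⁻ x, f x := by
  refine (lintegral_prod _ (hf.comp measurable_fst).aemeasurable).trans ?_
  refine (lintegral_congr fun x => ?_).trans (lintegral_const_mul _ hf)
  exact (lintegral_const (f x)).trans (by rw [volume_torus_univ, mul_comm])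

theorem memLp_gaussian_fst {b : ℝ} (hb : 0 < b) (A : ℝ) :
    MemLp (fun p : Domain d m => (A : ℂ) * gaussian d b p.1) 2 := by
  refine MemLp.const_mul (memLp_two_of_lintegral_enorm_sq_lt_top
    ((continuous_gaussian b).comp continuous_fst).aestronglyMeasurable ?_) _
  refine (lintegral_domain_fst (f := fun x => ‖gaussian d b x‖ₑ ^ 2)
    ((continuous_gaussian b).measurable.enorm.pow_const 2)).trans_lt ?_
  exact ENNReal.mul_lt_top ENNReal.ofReal_lt_top (lintegral_enorm_sq_lt_top (memLp_gaussian hb))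

/-- The function `A exp (-b |x|²)` on `ℝ^d × 𝕋^m`, constant in the torus variable. -/
noncomputable def gaussianLp (d m : ℕ) {b : ℝ} (hb : 0 < b) (A : ℝ) : L2 d m :=
  (memLp_gaussian_fst hb A).toLp

theorem gaussianLp_ae {b : ℝ} (hb : 0 < b) (A : ℝ) : gaussianLp d m hb A =ᵐ[volume]
    fun p => (A : ℂ) * gaussian d b p.1 := (memLp_gaussian_fst hb A).coeFn_toLp

theorem lintegral_enorm_gaussianLp_rpow {b : ℝ} (hb : 0 < b) {A : ℝ} (hA : 0 ≤ A) {q : ℝ}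
    (hq : 0 < q) : ∫⁻ p, ‖gaussianLp d m hb A p‖ₑ ^ q =
      ENNReal.ofReal (A ^ q * ((2 * Real.pi) ^ m * (Real.pi / (q * b)) ^ ((d : ℝ) / 2))) := by
  have hpi := Real.pi_pos
  have h1 : ∫⁻ p, ‖gaussianLp d m hb A p‖ₑ ^ q =
      ∫⁻ p : Domain d m, ENNReal.ofReal (A ^ q) * ‖gaussian d b p.1‖ₑ ^ q := by
    refine lintegral_congr_ae ?_
    filter_upwards [gaussianLp_ae (m := m) hb A] with p hp
    rw [hp, enorm_mul, ENNReal.mul_rpow_of_nonneg _ _ hq.le, ← ofReal_norm (A : ℂ),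
      Complex.norm_real, Real.norm_of_nonneg hA, ENNReal.ofReal_rpow_of_nonneg hA hq.le]
  rw [h1, lintegral_const_mul' _ _ ENNReal.ofReal_ne_top,
    lintegral_domain_fst (f := fun x => ‖gaussian d b x‖ₑ ^ q)
    ((continuous_gaussian b).measurable.enorm.pow_const q), lintegral_enorm_gaussian_rpow hb hq,
    ← ENNReal.ofReal_mul (by positivity), ← ENNReal.ofReal_mul (by positivity)]

theorem torusCoeffLp_gaussianLp {b : ℝ} (hb : 0 < b) (A : ℝ) (k : Fin m → ℤ) :
    torusCoeffLp (gaussianLp d m hb A) k =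
      if k = 0 then (A : ℂ) • (memLp_gaussian hb).toLp else 0 := by
  have h1 : torusCoeffLp (gaussianLp d m hb A) k =ᵐ[volume]
      fun x => (((2 * Real.pi) ^ m)⁻¹ : ℝ) •
        ((∫ y : Torus m, torusChar (-k) y) * ((A : ℂ) * gaussian d b x)) := by
    filter_upwards [torusCoeffLp_ae (gaussianLp d m hb A) k,
      torusCoeff_congr_ae (gaussianLp_ae hb A) k] with x hx1 hx2
    rw [hx1, hx2]
    exact congrArg _ (integral_mul_const ((A : ℂ) * gaussian d b x) _)
  ext1
  refine h1.trans ?_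
  split_ifs with hk
  · subst hk
    filter_upwards [Lp.coeFn_smul (A : ℂ) (memLp_gaussian (d := d) hb).toLp,
      (memLp_gaussian (d := d) hb).coeFn_toLp] with x hx1 hx2
    have h0 : ∫ y : Torus m, torusChar (-(0 : Fin m → ℤ)) y = ((2 * Real.pi) ^ m : ℝ) := by
      simp [torusChar, Measure.real, volume_torus_univ, Real.pi_pos.le]
    have hpos : 0 < (2 * Real.pi) ^ m := pow_pos Real.two_pi_pos m
    rw [hx1, Pi.smul_apply, hx2, h0, smul_eq_mul, Complex.real_smul, ← mul_assoc,
      ← Complex.ofReal_mul, inv_mul_cancel₀ hpos.ne', Complex.ofReal_one, one_mul]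
  · rw [integral_torusChar_neg hk]
    filter_upwards [Lp.coeFn_zero ℂ 2 (volume : Measure (EuclideanSpace ℝ (Fin d)))] with x hx
    rw [hx]
    simp

/-- The symbol `s ^ σ` is absorbed by half of the Gaussian decay. -/
theorem rpow_mul_exp_le {σ : ℝ} (hσ0 : 0 < σ) (hσ1 : σ < 1) {b s : ℝ} (hb : 0 < b) (hs : 0 ≤ s) :
    s ^ σ * Real.exp (-s / (2 * b)) ≤ 4 * b ^ σ * Real.exp (-s / (4 * b)) := by
  have hx : 0 ≤ s / b := by positivity
  have h1 : (s / b) ^ σ ≤ 4 * Real.exp (s / b / 4) := by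
    have h2 : (s / b) ^ σ ≤ 1 + s / b := by
      rcases le_total (s / b) 1 with h | h
      · have := Real.rpow_le_one hx h hσ0.le
        linarith
      · have := Real.rpow_le_rpow_of_exponent_le h hσ1.le
        rw [Real.rpow_one] at this
        linarith
    have h3 := Real.add_one_le_exp (s / b / 4)
    linarith
  have h4 : s ^ σ = b ^ σ * (s / b) ^ σ := by
    rw [← Real.mul_rpow hb.le hx, mul_div_cancel₀ _ hb.ne']
  calc s ^ σ * Real.exp (-s / (2 * b))
      ≤ b ^ σ * (4 * Real.exp (s / b / 4)) * Real.exp (-s / (2 * b)) := by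
        rw [h4]; gcongr
    _ = 4 * b ^ σ * (Real.exp (s / b / 4) * Real.exp (-s / (2 * b))) := by ring
    _ = _ := by
        rw [← Real.exp_add]
        congr 2
        field_simp
        ring

theorem fracLaplaceNormSq_gaussianLp_le {σ : ℝ} (hσ0 : 0 < σ) (hσ1 : σ < 1) {b : ℝ} (hb : 0 < b)
    (A : ℝ) : fracLaplaceNormSq σ (gaussianLp d m hb A) ≤
      ENNReal.ofReal (4 * b ^ σ * (A ^ 2 * ((2 * Real.pi) ^ m * (Real.pi / b) ^ ((d : ℝ) / 2)))) := by
  have hpi := Real.pi_pos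
  have hk : ∀ k : Fin m → ℤ, k ≠ 0 → ∫⁻ ξ : EuclideanSpace ℝ (Fin d),
      ENNReal.ofReal (laplaceSymbol ξ k ^ σ) *
        ‖fourierTransform (gaussianLp d m hb A) k ξ‖ₑ ^ 2 = 0 := by
    intro k hk
    rw [fourierTransform_eq, torusCoeffLp_gaussianLp, if_neg hk, map_zero]
    refine lintegral_eq_zero_of_ae_eq_zero ?_
    filter_upwards [Lp.coeFn_zero ℂ 2 (volume : Measure (EuclideanSpace ℝ (Fin d)))] with x hx
    simp
  rw [fracLaplaceNormSq, multiplierNormSq, tsum_eq_single 0 hk]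
  have h0 : fourierTransform (gaussianLp d m hb A) 0 =ᵐ[volume]
      fun ξ => (A : ℂ) * 𝓕 (gaussian d b) ξ := by
    rw [fourierTransform_eq, torusCoeffLp_gaussianLp, if_pos rfl, map_smul]
    have h1 : Lp.fourierTransformₗᵢ (EuclideanSpace ℝ (Fin d)) ℂ (memLp_gaussian hb).toLp =
        (memLp_fourier_gaussian hb).toLp :=
      fourier_toLp_of_integrable (integrable_gaussian hb) (memLp_gaussian hb)
        (memLp_fourier_gaussian hb)
    rw [h1]
    filter_upwards [Lp.coeFn_smul (A : ℂ) (memLp_fourier_gaussian (d := d) hb).toLp,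
      (memLp_fourier_gaussian (d := d) hb).coeFn_toLp] with ξ h2 h3
    rw [h2, Pi.smul_apply, h3, smul_eq_mul]
  calc _ ≤ ENNReal.ofReal ((2 * Real.pi) ^ m) * ∫⁻ ξ : EuclideanSpace ℝ (Fin d),
        ENNReal.ofReal (A ^ 2 * ((Real.pi / b) ^ (d : ℝ) * (4 * b ^ σ))) *
          ENNReal.ofReal (Real.exp (-(Real.pi ^ 2 / b) * ‖ξ‖ ^ 2)) := by
        refine mul_le_mul_right (lintegral_mono_ae ?_) _
        filter_upwards [h0] with ξ hξ
        have hA : ‖(A : ℂ)‖ₑ ^ 2 = ENNReal.ofReal (A ^ 2) := by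
          rw [← ofReal_norm, Complex.norm_real, ← ENNReal.ofReal_pow (norm_nonneg _),
            Real.norm_eq_abs, sq_abs]
        have hs : laplaceSymbol ξ (0 : Fin m → ℤ) = (2 * Real.pi * ‖ξ‖) ^ 2 := by
          simp [laplaceSymbol]
        rw [hξ, enorm_mul, mul_pow, hA, enorm_fourier_gaussian_sq hb, hs,
          ← ENNReal.ofReal_mul (by positivity), ← ENNReal.ofReal_mul (by positivity),
          ← ENNReal.ofReal_mul (by positivity)]
        refine ENNReal.ofReal_le_ofReal ?_
        have h5 := rpow_mul_exp_le hσ0 hσ1 hb (sq_nonneg (2 * Real.pi * ‖ξ‖))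
        have h6 : -(2 * Real.pi * ‖ξ‖) ^ 2 / (4 * b) = -(Real.pi ^ 2 / b) * ‖ξ‖ ^ 2 := by
          field_simp; ring
        rw [h6] at h5
        calc _ = A ^ 2 * (Real.pi / b) ^ (d : ℝ) * (((2 * Real.pi * ‖ξ‖) ^ 2) ^ σ *
              Real.exp (-(2 * Real.pi * ‖ξ‖) ^ 2 / (2 * b))) := by ring
          _ ≤ A ^ 2 * (Real.pi / b) ^ (d : ℝ) *
              (4 * b ^ σ * Real.exp (-(Real.pi ^ 2 / b) * ‖ξ‖ ^ 2)) := by gcongr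
          _ = _ := by ring
    _ = _ := by
        rw [lintegral_const_mul' _ _ ENNReal.ofReal_ne_top,
          lintegral_exp_neg_mul_sq_norm (by positivity), ← ENNReal.ofReal_mul (by positivity),
          ← ENNReal.ofReal_mul (by positivity)]
        congr 1
        have h7 : (Real.pi / b) ^ (d : ℝ) * (Real.pi / (Real.pi ^ 2 / b)) ^ ((d : ℝ) / 2) =
            (Real.pi / b) ^ ((d : ℝ) / 2) := by
          have h8 : Real.pi / (Real.pi ^ 2 / b) = (Real.pi / b)⁻¹ := by field_simp
          rw [h8, Real.inv_rpow (by positivity), ← Real.rpow_neg (by positivity),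
            ← Real.rpow_add (by positivity)]
          congr 1
          ring
        rw [← h7]
        ring

/-- A Gaussian in `ℝ^d`, constant along the torus, normalized to mass `c` and sufficiently spread out,
has negative energy. -/
theorem exists_mem_massSphere_energy_neg (hd : 1 ≤ d) {σ : ℝ} (hσ0 : 0 < σ)
    (hσ1 : σ < 1) {α : ℝ} (hα0 : 0 < α) (hα : α < 4 * σ / ((d : ℝ) + m)) {c : ℝ} (hc : 0 < c) :
    ∃ u ∈ massSphere d m σ c, energy σ α u < 0 := by
  have hpi := Real.pi_pos
  have hd' : (1 : ℝ) ≤ d := by exact_mod_cast hd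
  set e : ℝ := (d : ℝ) / 2 with he
  set B : ℝ := c * ((2 * Real.pi) ^ m)⁻¹ * (2 / Real.pi) ^ e with hB
  have hB0 : 0 < B := by positivity
  have hexp : 0 < σ - e * (α / 2) := by
    rw [lt_div_iff₀ (by positivity)] at hα
    have : α * d ≤ α * (d + m) := by
      gcongr
      exact le_add_of_nonneg_right (Nat.cast_nonneg m)
    rw [he]
    nlinarith
  -- For small `b` the kinetic energy, of order `b ^ σ`, is smaller than the potential energy, of
  -- order `b ^ (e α / 2)`.
  obtain ⟨b, hb, hb0⟩ : ∃ b : ℝ, 2 * 2 ^ e * b ^ (σ - e * (α / 2)) <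
      1 / (α + 2) * B ^ (α / 2) * (2 / (α + 2)) ^ e ∧ 0 < b := by
    have h1 : Filter.Tendsto (fun b : ℝ => 2 * 2 ^ e * b ^ (σ - e * (α / 2)))
        (nhdsWithin 0 (Set.Ioi 0)) (nhds 0) := by
      have : ContinuousAt (fun b : ℝ => 2 * 2 ^ e * b ^ (σ - e * (α / 2))) 0 :=
        continuousAt_const.mul (continuousAt_id.rpow_const (Or.inr hexp.le))
      have h2 := this.tendsto
      simp only [Real.zero_rpow hexp.ne', mul_zero] at h2
      exact h2.mono_left nhdsWithin_le_nhds
    exact ((h1.eventually (gt_mem_nhds (by positivity))).and self_mem_nhdsWithin).exists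
  set A : ℝ := Real.sqrt (B * b ^ e) with hA
  have hA0 : 0 < A := Real.sqrt_pos.2 (by positivity)
  have hA2 : A ^ 2 = B * b ^ e := Real.sq_sqrt (by positivity)
  -- the normalization of `A`, in the form in which it is used three times
  have hnorm : ∀ q : ℝ, 0 < q →
      A ^ 2 * ((2 * Real.pi) ^ m * (Real.pi / (q * b)) ^ e) = c * (2 / q) ^ e := by
    intro q hq
    have h1 : (2 / Real.pi) ^ e * b ^ e * (Real.pi / (q * b)) ^ e = (2 / q) ^ e := by
      rw [← Real.mul_rpow (by positivity) hb0.le, ← Real.mul_rpow (by positivity) (by positivity)]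
      congr 1
      field_simp
    rw [hA2, hB, ← h1]
    field_simp
  set u := gaussianLp d m hb0 A with hu
  have hmass : ‖u‖ ^ 2 = c := by
    have h1 := lintegral_enorm_gaussianLp_rpow (d := d) (m := m) hb0 hA0.le two_pos
    simp only [ENNReal.rpow_ofNat, Real.rpow_ofNat] at h1
    rw [lintegral_enorm_sq_eq, ← he, hnorm 2 two_pos, div_self two_ne_zero, Real.one_rpow, mul_one,
      ← ofReal_norm, ← ENNReal.ofReal_pow (norm_nonneg _)] at h1
    exact (ENNReal.ofReal_eq_ofReal_iff (by positivity) hc.le).1 h1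
  have hK : fracLaplaceNormSq σ u ≤ ENNReal.ofReal (4 * b ^ σ * (c * 2 ^ e)) := by
    have h1 := fracLaplaceNormSq_gaussianLp_le (d := d) (m := m) hσ0 hσ1 hb0 A
    have h2 := hnorm 1 one_pos
    rw [one_mul, div_one] at h2
    rwa [← he, h2] at h1
  have hP : ∫⁻ p, ‖u p‖ₑ ^ (α + 2) =
      ENNReal.ofReal ((B * b ^ e) ^ (α / 2) * (c * (2 / (α + 2)) ^ e)) := by
    rw [lintegral_enorm_gaussianLp_rpow hb0 hA0.le (by positivity), ← hnorm (α + 2) (by positivity),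
      ← he]
    congr 1
    have h3 : A ^ (α + 2) = (B * b ^ e) ^ (α / 2) * A ^ 2 := by
      rw [← hA2, Real.rpow_add hA0, Real.rpow_ofNat, ← Real.rpow_natCast, ← Real.rpow_mul hA0.le]
      congr 2
      push_cast
      ring
    rw [h3]
    ring
  have hKt : fracLaplaceNormSq σ u < ∞ := hK.trans_lt ENNReal.ofReal_lt_top
  refine ⟨u, ⟨(mem_sobolev_iff hσ0 hσ1 u).2 hKt, hmass⟩, ?_⟩
  rw [energy_eq_coe hα0 hKt (hP ▸ ENNReal.ofReal_lt_top), realEnergy, kinetic, potential, hP,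
    ENNReal.toReal_ofReal (by positivity)]
  have hK' := ENNReal.toReal_le_of_le_ofReal (by positivity) hK
  norm_cast
  have h4 : (B * b ^ e) ^ (α / 2) = B ^ (α / 2) * b ^ (e * (α / 2)) := by
    rw [Real.mul_rpow hB0.le (by positivity), ← Real.rpow_mul hb0.le]
  have h5 : b ^ σ = b ^ (σ - e * (α / 2)) * b ^ (e * (α / 2)) := by
    rw [← Real.rpow_add hb0]
    congr 1
    ring
  have h6 : 0 < c * b ^ (e * (α / 2)) := by positivity
  have h7 := mul_lt_mul_of_pos_right hb h6
  rw [h5] at hK'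
  rw [h4]
  nlinarith

/-! ### Scaling, splitting and existence of minimizers -/

theorem fracLaplaceNormSq_smul (σ : ℝ) {t : ℝ} (ht : 0 ≤ t) (u : L2 d m) :
    fracLaplaceNormSq σ ((t : ℂ) • u) = ENNReal.ofReal (t ^ 2) * fracLaplaceNormSq σ u := by
  rw [fracLaplaceNormSq, fracLaplaceNormSq, multiplierNormSq, multiplierNormSq,
    mul_left_comm (ENNReal.ofReal (t ^ 2)), ← ENNReal.tsum_mul_left (a := ENNReal.ofReal (t ^ 2))]
  congr 1
  refine tsum_congr fun k => ?_
  rw [← lintegral_const_mul' _ _ ENNReal.ofReal_ne_top, fourierTransform_smul]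
  refine lintegral_congr_ae ?_
  filter_upwards [Lp.coeFn_smul (t : ℂ) (fourierTransform u k)] with ξ hξ
  rw [hξ, Pi.smul_apply, smul_eq_mul, enorm_mul, mul_pow, ← ofReal_norm (t : ℂ),
    Complex.norm_real, Real.norm_of_nonneg ht, ENNReal.ofReal_pow ht, mul_left_comm]

theorem lintegral_rpow_smul {q : ℝ} (hq : 0 ≤ q) {t : ℝ} (ht : 0 ≤ t) (u : L2 d m) :
    ∫⁻ p, ‖((t : ℂ) • u : L2 d m) p‖ₑ ^ q = ENNReal.ofReal (t ^ q) * ∫⁻ p, ‖u p‖ₑ ^ q := by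
  rw [← lintegral_const_mul' _ _ ENNReal.ofReal_ne_top]
  refine lintegral_congr_ae ?_
  filter_upwards [Lp.coeFn_smul (t : ℂ) u] with p hp
  rw [hp, Pi.smul_apply, smul_eq_mul, enorm_mul, ENNReal.mul_rpow_of_nonneg _ _ hq,
    ← ofReal_norm (t : ℂ), Complex.norm_real, Real.norm_of_nonneg ht,
    ENNReal.ofReal_rpow_of_nonneg ht hq]

theorem lintegral_rpow_translate (q : ℝ) (h : Domain d m) (u : L2 d m) :
    ∫⁻ p, ‖translate h u p‖ₑ ^ q = ∫⁻ p, ‖u p‖ₑ ^ q := by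
  rw [← lintegral_add_right_eq_self (fun p => ‖u p‖ₑ ^ q) h]
  refine lintegral_congr_ae ?_
  filter_upwards [translate_ae h u] with p hp
  rw [hp]

theorem ballAverage_translate (r : ℝ) (h : Domain d m) (u : L2 d m) :
    ballAverage r (translate h u) 0 = ballAverage r u h := by
  rw [ballAverage_eq r u h, ballAverage]
  refine average_congr (ae_restrict_of_ae ?_)
  filter_upwards [translate_ae h u] with p hp
  rw [hp, add_comm]

theorem potential_pos {α : ℝ} (hα : 0 < α) {u : L2 d m} (hu : u ≠ 0)
    (hP : ∫⁻ p, ‖u p‖ₑ ^ (α + 2) < ∞) : 0 < potential α u := by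
  refine ENNReal.toReal_pos (fun h => hu ?_) hP.ne
  rw [lintegral_eq_zero_iff' ((Lp.aestronglyMeasurable u).enorm.pow_const _)] at h
  refine (Lp.eq_zero_iff_ae_eq_zero (f := u)).2 ?_
  filter_upwards [h] with p hp
  simpa [show ¬ α + 2 < 0 by linarith, show (0 : ℝ) < α + 2 by linarith] using hp

/-- In the mass-subcritical range the potential energy is controlled by half of the kinetic
energy, so that the energy is coercive on bounded sets of `L²`. -/
theorem exists_potential_le (hd : 1 ≤ d) {σ : ℝ} (hσ0 : 0 < σ) (hσ1 : σ < 1) {α : ℝ}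
    (hα0 : 0 < α) (hα : α < 4 * σ / ((d : ℝ) + m)) (M : ℝ) :
    ∃ C : ℝ, 0 < C ∧ ∀ u : L2 d m, ‖u‖ ^ 2 ≤ M → fracLaplaceNormSq σ u < ∞ →
      ∫⁻ p, ‖u p‖ₑ ^ (α + 2) < ∞ ∧ potential α u ≤ (α + 2) * (C + 1 / 4 * kinetic σ u) := by
  obtain ⟨C, hC, h⟩ := exists_lintegral_rpow_le (d := d) (m := m) hd hσ0 hσ1 hα0 hα M
    (ε := (α + 2) * (1 / 4)) (by positivity)
  refine ⟨C / (α + 2), by positivity, fun u hM hK => ?_⟩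
  have h1 : ENNReal.ofReal C + ENNReal.ofReal ((α + 2) * (1 / 4)) * fracLaplaceNormSq σ u < ∞ :=
    ENNReal.add_lt_top.2 ⟨ENNReal.ofReal_lt_top, ENNReal.mul_lt_top ENNReal.ofReal_lt_top hK⟩
  refine ⟨(h u hM).trans_lt h1, (ENNReal.toReal_mono h1.ne (h u hM)).trans_eq ?_⟩
  rw [ENNReal.toReal_add ENNReal.ofReal_ne_top (ENNReal.mul_lt_top ENNReal.ofReal_lt_top hK).ne,
    ENNReal.toReal_mul, ENNReal.toReal_ofReal hC.le, ENNReal.toReal_ofReal (by positivity), kinetic]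
  field_simp

/-- The bound obtained by rescaling `u` to mass `c`. -/
theorem le_realEnergy_smul {σ α : ℝ} (hα : 0 < α) {c μ : ℝ} (hc : 0 < c)
    (hmin : ∀ u : L2 d m, ‖u‖ ^ 2 = c → fracLaplaceNormSq σ u < ∞ → μ ≤ realEnergy σ α u)
    {u : L2 d m} (hu : u ≠ 0) (hK : fracLaplaceNormSq σ u < ∞) :
    μ ≤ c / ‖u‖ ^ 2 * (realEnergy σ α u -
      1 / (α + 2) * ((c / ‖u‖ ^ 2) ^ (α / 2) - 1) * potential α u) := by
  have ha : 0 < ‖u‖ := norm_pos_iff.2 hu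
  set s := c / ‖u‖ ^ 2 with hs
  have hs0 : 0 < s := by positivity
  set t := Real.sqrt s with ht
  have ht0 : 0 ≤ t := Real.sqrt_nonneg s
  have ht2 : t ^ 2 = s := Real.sq_sqrt hs0.le
  have hKs := fracLaplaceNormSq_smul σ ht0 u
  have h := hmin ((t : ℂ) • u) (by
      rw [norm_smul, Complex.norm_real, Real.norm_of_nonneg ht0, mul_pow, ht2, hs]
      field_simp) (by rw [hKs]; exact ENNReal.mul_lt_top ENNReal.ofReal_lt_top hK)
  have htq : t ^ (α + 2) = s * s ^ (α / 2) := by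
    rw [ht, Real.sqrt_eq_rpow, ← Real.rpow_mul hs0.le]
    nth_rewrite 2 [← Real.rpow_one s]
    rw [← Real.rpow_add hs0]
    congr 1
    ring
  rw [realEnergy, kinetic, potential, hKs, lintegral_rpow_smul (by positivity) ht0,
    ENNReal.toReal_mul, ENNReal.toReal_mul, ENNReal.toReal_ofReal (by positivity),
    ENNReal.toReal_ofReal (by positivity), htq, ht2] at h
  refine h.trans_eq ?_
  rw [realEnergy, kinetic, potential]
  ring

/-- The minimal energy per unit of mass does not increase with the mass: `m_a / a ≥ m_c / c` for
`a ≤ c`. -/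
theorem mul_le_realEnergy {σ α : ℝ} (hα : 0 < α) {c μ : ℝ} (hc : 0 < c)
    (hmin : ∀ u : L2 d m, ‖u‖ ^ 2 = c → fracLaplaceNormSq σ u < ∞ → μ ≤ realEnergy σ α u)
    {u : L2 d m} (hu : ‖u‖ ^ 2 ≤ c) (hK : fracLaplaceNormSq σ u < ∞) :
    ‖u‖ ^ 2 / c * μ ≤ realEnergy σ α u := by
  rcases eq_or_ne u 0 with rfl | hu0
  · have hk : kinetic σ (0 : L2 d m) = 0 := by
      have := fracLaplaceNormSq_smul σ le_rfl (0 : L2 d m)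
      simp only [smul_zero] at this
      rw [kinetic, this, sq, zero_mul, ENNReal.ofReal_zero, zero_mul, ENNReal.toReal_zero]
    have hp : potential α (0 : L2 d m) = 0 := by
      have := lintegral_rpow_smul (q := α + 2) (by positivity) le_rfl (0 : L2 d m)
      simp only [smul_zero] at this
      rw [potential, this, Real.zero_rpow (by positivity), ENNReal.ofReal_zero, zero_mul,
        ENNReal.toReal_zero]
    simp [realEnergy, hk, hp]
  have ha : 0 < ‖u‖ ^ 2 := pow_pos (norm_pos_iff.2 hu0) 2
  have h := le_realEnergy_smul hα hc hmin hu0 hK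
  have hs : 1 ≤ (c / ‖u‖ ^ 2) ^ (α / 2) :=
    Real.one_le_rpow ((one_le_div ha).2 hu) (by positivity)
  have h1 : 0 ≤ 1 / (α + 2) * ((c / ‖u‖ ^ 2) ^ (α / 2) - 1) * potential α u :=
    mul_nonneg (mul_nonneg (by positivity) (by linarith)) (potential_nonneg α u)
  calc ‖u‖ ^ 2 / c * μ ≤ ‖u‖ ^ 2 / c * (c / ‖u‖ ^ 2 * realEnergy σ α u) := by
        gcongr
        refine h.trans ?_
        gcongr
        linarith
    _ = _ := by field_simp

/-- The inequality of `mul_le_realEnergy` is strict for nonzero functions of smaller mass, because their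
potential energy is positive. -/
theorem mul_lt_realEnergy {σ α : ℝ} (hα : 0 < α) {c μ : ℝ} (hc : 0 < c)
    (hmin : ∀ u : L2 d m, ‖u‖ ^ 2 = c → fracLaplaceNormSq σ u < ∞ → μ ≤ realEnergy σ α u)
    {u : L2 d m} (hu0 : u ≠ 0) (hu : ‖u‖ ^ 2 < c) (hK : fracLaplaceNormSq σ u < ∞)
    (hP : ∫⁻ p, ‖u p‖ₑ ^ (α + 2) < ∞) :
    ‖u‖ ^ 2 / c * μ < realEnergy σ α u := by
  have ha : 0 < ‖u‖ ^ 2 := pow_pos (norm_pos_iff.2 hu0) 2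
  have h := le_realEnergy_smul hα hc hmin hu0 hK
  have hs : 1 < (c / ‖u‖ ^ 2) ^ (α / 2) :=
    Real.one_lt_rpow ((one_lt_div ha).2 hu) (by positivity)
  have h1 : 0 < 1 / (α + 2) * ((c / ‖u‖ ^ 2) ^ (α / 2) - 1) * potential α u :=
    mul_pos (mul_pos (by positivity) (by linarith)) (potential_pos hα hu0 hP)
  calc ‖u‖ ^ 2 / c * μ < ‖u‖ ^ 2 / c * (c / ‖u‖ ^ 2 * realEnergy σ α u) := by
        gcongr
        refine h.trans_lt ?_
        gcongr
        linarith
    _ = _ := by field_simp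

/-- The half of the Brezis–Lieb lemma that is needed: along a bounded sequence tending to `0` almost
everywhere, the potential energy is asymptotically at most additive. -/
theorem eventually_potential_add_le {α : ℝ} (hα : 0 < α) {w : ℕ → L2 d m} {v : L2 d m}
    (hw : ∀ᵐ p, Tendsto (fun n => w n p) atTop (𝓝 0)) (hwi : ∀ n, ∫⁻ p, ‖w n p‖ₑ ^ (α + 2) < ∞)
    (hvi : ∫⁻ p, ‖v p‖ₑ ^ (α + 2) < ∞) {B : ℝ} (hB : ∀ n, potential α (w n) ≤ B) {ε : ℝ}
    (hε : 0 < ε) :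
    ∀ᶠ n in atTop, potential α (w n + v) ≤ potential α (w n) + potential α v + ε := by
  -- the factor `t ^ (1 - q)` is close enough to `1` to be absorbed by the bound `B`
  obtain ⟨t, ht, ht0, ht1⟩ : ∃ t : ℝ, (t ^ (1 - (α + 2)) - 1) * B < ε / 2 ∧ 0 < t ∧ t < 1 := by
    have h1 : ContinuousAt (fun t : ℝ => (t ^ (1 - (α + 2)) - 1) * B) 1 :=
      ((continuousAt_id.rpow_const (Or.inl one_ne_zero)).sub_const 1).mul_const B
    have h2 : Tendsto (fun t : ℝ => (t ^ (1 - (α + 2)) - 1) * B) (𝓝[<] 1) (𝓝 0) := by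
      have h3 := h1.tendsto
      simp only [Real.one_rpow, sub_self, zero_mul] at h3
      exact h3.mono_left nhdsWithin_le_nhds
    have h4 : ∀ᶠ t : ℝ in 𝓝[<] 1, 0 < t := nhdsWithin_le_nhds (lt_mem_nhds one_pos)
    exact ((h2.eventually (gt_mem_nhds (half_pos hε))).and (h4.and self_mem_nhdsWithin)).exists
  filter_upwards [eventually_lintegral_add_rpow_le (q := α + 2) (by linarith) ht0 ht1
    (fun n => (Lp.aestronglyMeasurable (w n)).aemeasurable)
    (Lp.aestronglyMeasurable v).aemeasurable hw (fun n => (hwi n).ne) hvi.ne (half_pos hε)] with n hn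
  have h1 : potential α (w n + v) = (∫⁻ p, ‖w n p + v p‖ₑ ^ (α + 2)).toReal := by
    refine congrArg _ (lintegral_congr_ae ?_)
    filter_upwards [Lp.coeFn_add (w n) v] with p hp
    rw [hp, Pi.add_apply]
  have h2 : 1 ≤ t ^ (1 - (α + 2)) :=
    Real.one_le_rpow_of_pos_of_le_one_of_nonpos ht0 ht1.le (by linarith)
  have h3 : (t ^ (1 - (α + 2)) - 1) * potential α (w n) ≤ (t ^ (1 - (α + 2)) - 1) * B :=
    mul_le_mul_of_nonneg_left (hB n) (by linarith)
  rw [h1]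
  unfold potential at h3 ⊢
  linarith

/-- A sequence with bounded mass and kinetic energy and with nonvanishing potential energy has,
after translations and passage to a subsequence, a nonzero weak limit, along which the kinetic
energy splits. -/
theorem exists_translate_weakTendsto (hd : 1 ≤ d) {σ : ℝ} (hσ0 : 0 < σ) (hσ1 : σ < 1) {α : ℝ}
    (hα0 : 0 < α) (hα : α < 4 * σ / ((d : ℝ) + m)) {u : ℕ → L2 d m} {M K δ : ℝ} (hδ : 0 < δ)
    (hM : ∀ n, ‖u n‖ ^ 2 ≤ M) (hK : ∀ n, fracLaplaceNormSq σ (u n) ≤ ENNReal.ofReal K)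
    (hP : ∀ n, ENNReal.ofReal δ ≤ ∫⁻ p, ‖u n p‖ₑ ^ (α + 2)) :
    ∃ (h : ℕ → Domain d m) (φ : ℕ → ℕ) (v : L2 d m), StrictMono φ ∧ v ≠ 0 ∧
      fracLaplaceNormSq σ v < ∞ ∧ WeakTendsto (fun n => translate (h n) (u (φ n))) v ∧
      (∀ n, fracLaplaceNormSq σ (translate (h n) (u (φ n)) - v) < ∞) ∧
      Tendsto (fun n => kinetic σ (u (φ n)) - kinetic σ (translate (h n) (u (φ n)) - v)) atTop
        (𝓝 (kinetic σ v)) := by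
  obtain ⟨r, η, hr, hη, hball⟩ := exists_le_norm_ballAverage (d := d) (m := m) hd hσ0 hσ1 hα0 hα
    M K hδ
  choose h hh using fun n => hball (u n) (hM n) (hK n) (hP n)
  have hKt : ∀ n, fracLaplaceNormSq σ (translate (h n) (u n)) = fracLaplaceNormSq σ (u n) :=
    fun n => multiplierNormSq_translate _ _ _
  obtain ⟨v, φ, hφ, hw, hKv, hKw, hlim⟩ := exists_weakTendsto_sobolev
    (u := fun n => translate (h n) (u n)) (M := M) (K := K)
    (fun n => by rw [LinearIsometry.norm_map]; exact hM n)
    (fun n => by rw [hKt]; exact hK n)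
  refine ⟨h ∘ φ, φ, v, hφ, ?_, hKv, hw, hKw, ?_⟩
  · rintro rfl
    have h1 := (hw.tendsto_ballAverage r 0).norm
    have h2 : ballAverage r (0 : L2 d m) 0 = 0 := by
      rw [ballAverage, setAverage_congr_fun measurableSet_closedBall
        (g := fun _ => (0 : ℂ))]
      · simp
      · filter_upwards [Lp.coeFn_zero ℂ 2 (volume : Measure (Domain d m))] with p hp _
        exact hp
    rw [h2, norm_zero] at h1
    refine absurd (ge_of_tendsto' h1 fun n => ?_) (not_le.2 hη)
    simp only [Function.comp_apply, ballAverage_translate]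
    exact (hh (φ n)).le
  · simp only [hKt] at hlim
    exact hlim

/-- A minimizing sequence with negative limit energy produces a minimizer. -/
theorem exists_realEnergy_eq (hd : 1 ≤ d) {σ : ℝ} (hσ0 : 0 < σ) (hσ1 : σ < 1) {α : ℝ}
    (hα0 : 0 < α) (hα : α < 4 * σ / ((d : ℝ) + m)) {c μ : ℝ} (hc : 0 < c) (hμ : μ < 0)
    (hmin : ∀ u : L2 d m, ‖u‖ ^ 2 = c → fracLaplaceNormSq σ u < ∞ → μ ≤ realEnergy σ α u)
    (hinf : ∀ ε > 0, ∃ u : L2 d m, ‖u‖ ^ 2 = c ∧ fracLaplaceNormSq σ u < ∞ ∧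
      realEnergy σ α u < μ + ε) :
    ∃ v : L2 d m, ‖v‖ ^ 2 = c ∧ fracLaplaceNormSq σ v < ∞ ∧ realEnergy σ α v = μ := by
  have hq : 0 < α + 2 := by positivity
  choose u hu hKu hEu using fun n : ℕ => hinf (-μ / 2 * (1 / ((n : ℝ) + 1)))
    (mul_pos (by linarith) (by positivity))
  have hE2 : ∀ n, realEnergy σ α (u n) ≤ μ / 2 := by
    intro n
    have h1 : 1 / ((n : ℝ) + 1) ≤ 1 := by
      rw [div_le_one (by positivity)]
      linarith [n.cast_nonneg (α := ℝ)]
    nlinarith [hEu n]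
  have hElim : ∀ ε > 0, ∀ᶠ n in atTop, realEnergy σ α (u n) < μ + ε := by
    intro ε hε
    have h1 := (tendsto_one_div_add_atTop_nhds_zero_nat (𝕜 := ℝ)).const_mul (-μ / 2)
    rw [mul_zero] at h1
    filter_upwards [h1.eventually (gt_mem_nhds hε)] with n hn
    linarith [hEu n]
  obtain ⟨C, hC, hcoer⟩ := exists_potential_le (d := d) (m := m) hd hσ0 hσ1 hα0 hα (4 * c)
  have hbound : ∀ w : L2 d m, ‖w‖ ^ 2 ≤ 4 * c → fracLaplaceNormSq σ w < ∞ →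
      1 / (α + 2) * potential α w ≤ C + 1 / 4 * kinetic σ w := by
    intro w h1 h2
    rw [one_div, inv_mul_le_iff₀ hq]
    exact (hcoer w h1 h2).2
  have hKle : ∀ n, kinetic σ (u n) ≤ 4 * C := by
    intro n
    have h1 := hbound (u n) (by rw [hu]; linarith) (hKu n)
    have h2 := hE2 n
    rw [realEnergy] at h2
    linarith
  -- negative energy forces the potential energy to stay away from zero
  have hPge : ∀ n, (α + 2) * (-μ / 2) ≤ potential α (u n) := by
    intro n
    have h1 := hE2 n
    have h2 := kinetic_nonneg σ (u n)
    rw [realEnergy] at h1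
    rw [← le_inv_mul_iff₀ hq, ← one_div]
    linarith
  obtain ⟨h, φ, v, hφ, hv0, hKv, hweak, hKw, hKlim⟩ := exists_translate_weakTendsto hd hσ0 hσ1 hα0
    hα (u := u) (M := c) (K := 4 * C) (δ := (α + 2) * (-μ / 2)) (by
      have : 0 < -μ / 2 := by linarith
      positivity) (fun n => (hu n).le)
    (fun n => (ENNReal.le_ofReal_iff_toReal_le (hKu n).ne (by positivity)).2 (hKle n))
    (fun n => (ENNReal.ofReal_le_iff_le_toReal
      (hcoer (u n) (by rw [hu]; linarith) (hKu n)).1.ne).2 (hPge n))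
  set x : ℕ → L2 d m := fun n => translate (h n) (u (φ n)) with hx
  set w : ℕ → L2 d m := fun n => x n - v with hw
  have hxn : ∀ n, ‖x n‖ ^ 2 = c := fun n => by rw [hx, LinearIsometry.norm_map, hu]
  have hmass : Tendsto (fun n => c - ‖w n‖ ^ 2) atTop (𝓝 (‖v‖ ^ 2)) := by
    simpa only [hxn] using hweak.norm_sq_sub
  have hvc : ‖v‖ ^ 2 ≤ c := le_of_tendsto' hmass fun n => by
    linarith [sq_nonneg ‖w n‖]
  have ha : 0 < ‖v‖ ^ 2 := pow_pos (norm_pos_iff.2 hv0) 2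
  have hwn : ∀ n, ‖w n‖ ^ 2 ≤ 4 * c := by
    intro n
    have h1 : ‖w n‖ ≤ ‖x n‖ + ‖v‖ := norm_sub_le _ _
    nlinarith [norm_nonneg (w n), sq_nonneg (‖x n‖ - ‖v‖), hxn n]
  obtain ⟨K, hK⟩ : ∃ K : ℝ, ∀ n, kinetic σ (w n) ≤ K := by
    obtain ⟨b, hb⟩ := hKlim.bddBelow_range
    refine ⟨4 * C - b, fun n => ?_⟩
    have h1 := hb ⟨n, rfl⟩
    simp only at h1
    linarith [hKle (φ n)]
  have hK0 : 0 ≤ K := (kinetic_nonneg σ _).trans (hK 0)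
  have hwweak : WeakTendsto w 0 := by
    intro y
    have h1 := (hweak y).sub_const (inner ℂ y v)
    rw [sub_self] at h1
    simpa only [hw, inner_sub_right, inner_zero_right] using h1
  obtain ⟨ψ, hψ, hae⟩ := exists_subseq_ae_tendsto_zero hσ0 hσ1 hwweak hwn
    (fun n => (ENNReal.le_ofReal_iff_toReal_le (hKw n).ne hK0).2 (hK n))
  have hPv := hcoer v (by linarith) hKv
  have hPx : ∀ n, potential α (x n) = potential α (u (φ n)) := fun n =>
    congrArg ENNReal.toReal (lintegral_rpow_translate _ _ _)
  have hBL : ∀ ε > 0, ∀ᶠ n in atTop, potential α (x (ψ n)) ≤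
      potential α (w (ψ n)) + potential α v + ε := by
    intro ε hε
    have h1 := eventually_potential_add_le (w := fun n => w (ψ n)) hα0 hae
      (fun n => (hcoer _ (hwn _) (hKw _)).1) hPv.1 (B := (α + 2) * (C + 1 / 4 * K))
      (fun n => (hcoer _ (hwn _) (hKw _)).2.trans (by gcongr; exact hK _)) hε
    simpa only [hw, sub_add_cancel] using h1
  -- the energy splits, and the remainder costs at least its share of the minimal energy
  have hEv : realEnergy σ α v ≤ ‖v‖ ^ 2 / c * μ := by
    refine le_of_forall_pos_le_add fun ε hε => ?_
    have hε4 : 0 < ε / 4 := by positivity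
    have hE' := (hφ.comp hψ).tendsto_atTop.eventually (hElim (ε / 4) hε4)
    have hK' := (hKlim.comp hψ.tendsto_atTop).eventually
      (lt_mem_nhds (sub_lt_self (kinetic σ v) hε4))
    have hm1 : Tendsto (fun n => ‖w (ψ n)‖ ^ 2 / c * μ) atTop (𝓝 ((c - ‖v‖ ^ 2) / c * μ)) := by
      have h1 := (((hmass.comp hψ.tendsto_atTop).const_sub c).div_const c).mul_const μ
      simpa only [Function.comp_def, sub_sub_cancel] using h1
    have hm2 := hm1.eventually (lt_mem_nhds (sub_lt_self _ hε4))
    have hm3 := (hmass.comp hψ.tendsto_atTop).eventually (lt_mem_nhds ha)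
    obtain ⟨n, h1, h2, h3, h4, h5⟩ :=
      (hE'.and (hK'.and (hm2.and (hm3.and (hBL (ε / 4) hε4))))).exists
    simp only [Function.comp_apply] at h1 h2 h4
    have h6 := mul_le_realEnergy hα0 hc hmin (u := w (ψ n)) (by linarith) (hKw _)
    rw [hPx] at h5
    have h7 : 1 / (α + 2) * potential α (u (φ (ψ n))) ≤
        1 / (α + 2) * potential α (w (ψ n)) + 1 / (α + 2) * potential α v + ε / 4 := by
      have h8 : 1 / (α + 2) ≤ 1 := by
        rw [div_le_one hq]
        linarith
      calc _ ≤ 1 / (α + 2) * (potential α (w (ψ n)) + potential α v + ε / 4) := by gcongr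
        _ ≤ _ := by nlinarith
    have h9 : (c - ‖v‖ ^ 2) / c * μ = μ - ‖v‖ ^ 2 / c * μ := by
      field_simp
    rw [h9] at h3
    change kinetic σ v - ε / 4 < kinetic σ (u (φ (ψ n))) - kinetic σ (w (ψ n)) at h2
    unfold realEnergy at h1 h6 ⊢
    linarith
  rcases hvc.lt_or_eq with hlt | heq
  · exact absurd hEv (not_le.2 (mul_lt_realEnergy hα0 hc hmin hv0 hlt hKv hPv.1))
  · refine ⟨v, heq, hKv, le_antisymm ?_ (hmin v heq hKv)⟩
    rwa [heq, div_self hc.ne', one_mul] at hEv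

end Waveguide

theorem mainTheorem5 (d m : ℕ) (hd : 1 ≤ d) (hm : 1 ≤ m)
    (σ : ℝ) (hσ0 : 0 < σ) (hσ1 : σ < 1)
    (α : ℝ) (hα0 : 0 < α) (hα : α < 4 * σ / ((d : ℝ) + (m : ℝ)))
    (c : ℝ) (hc : 0 < c) :
    (⊥ < Waveguide.groundEnergy d m σ α c ∧ Waveguide.groundEnergy d m σ α c < 0) ∧
      ∃ u ∈ Waveguide.massSphere d m σ c,
        Waveguide.energy σ α u = Waveguide.groundEnergy d m σ α c := by
  open Waveguide in
  obtain ⟨C, hC, hcoer⟩ := exists_potential_le (d := d) (m := m) hd hσ0 hσ1 hα0 hα c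
  have henergy : ∀ u : L2 d m, ‖u‖ ^ 2 = c → fracLaplaceNormSq σ u < ∞ →
      energy σ α u = (realEnergy σ α u : EReal) := fun u hu hK =>
    energy_eq_coe hα0 hK (hcoer u hu.le hK).1
  have hbdd : ((-C : ℝ) : EReal) ≤ groundEnergy d m σ α c := by
    refine le_iInf₂ fun u hu => ?_
    have hK := (mem_sobolev_iff hσ0 hσ1 u).1 hu.1
    rw [henergy u hu.2 hK, EReal.coe_le_coe_iff]
    have h1 : 1 / (α + 2) * potential α u ≤ C + 1 / 4 * kinetic σ u := by
      rw [one_div, inv_mul_le_iff₀ (by positivity)]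
      exact (hcoer u hu.2.le hK).2
    have h2 := kinetic_nonneg σ u
    rw [realEnergy]
    linarith
  have hbot : ⊥ < groundEnergy d m σ α c := (EReal.bot_lt_coe _).trans_le hbdd
  have hneg : groundEnergy d m σ α c < 0 := by
    obtain ⟨u, hu, hE⟩ := exists_mem_massSphere_energy_neg (m := m) hd hσ0 hσ1 hα0 hα hc
    exact (iInf₂_le u hu).trans_lt hE
  refine ⟨⟨hbot, hneg⟩, ?_⟩
  obtain ⟨μ, hμ⟩ : ∃ μ : ℝ, groundEnergy d m σ α c = μ :=
    ⟨_, (EReal.coe_toReal (hneg.trans EReal.zero_lt_top).ne hbot.ne').symm⟩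
  have hmem : ∀ u : L2 d m, u ∈ massSphere d m σ c ↔
      ‖u‖ ^ 2 = c ∧ fracLaplaceNormSq σ u < ∞ := fun u => by
    rw [← mem_sobolev_iff hσ0 hσ1 u, and_comm]
    rfl
  obtain ⟨v, hv, hKv, hEv⟩ := exists_realEnergy_eq hd hσ0 hσ1 hα0 hα hc (μ := μ)
    (by rw [hμ] at hneg; exact_mod_cast hneg)
    (fun u hu hK => by
      rw [← EReal.coe_le_coe_iff, ← hμ, ← henergy u hu hK]
      exact iInf₂_le u ((hmem u).2 ⟨hu, hK⟩))
    (fun ε hε => by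
      have h1 : groundEnergy d m σ α c < ((μ + ε : ℝ) : EReal) := by
        rw [hμ, EReal.coe_lt_coe_iff]
        linarith
      simp only [groundEnergy, iInf_lt_iff] at h1
      obtain ⟨u, hu, hlt⟩ := h1
      obtain ⟨hu1, hK⟩ := (hmem u).1 hu
      rw [henergy u hu1 hK, EReal.coe_lt_coe_iff] at hlt
      exact ⟨u, hu1, hK, hlt⟩)
  exact ⟨v, (hmem v).2 ⟨hv, hKv⟩, by rw [henergy v hv hKv, hEv, hμ]⟩
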